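/- All groups and graphs are finite. Let $d(G)$ denote the smallest size of a generating set of a group $G$, and let $|g|$ denote the order of $g\in G$. For a positive integer $m$ and a matrix $(T_{i,j})_{m\times m}$ of subsets of $G$ with $1\notin T_{i,i}$ and $T_{j,i}=T_{i,j}^{-1}$ for all $i,j$, the $m$-Cayley graph $\mathrm{Cay}(G,(T_{i,j})_{m\times m})$ is the graph with vertex set $G\times\{1,\dots,m\}$ and edges $\{(g,i),(tg,j)\}$ for $g\in G$, $i,j\in\{1,\dots,m\}$ and $t\in T_{i,j}$. If all $T_{i,i}$ are empty, the matrix is determined by the sets $T_{i,j}$ with $i<j$. An $m$-Haar graphical representation ($m$-HGR, $m\ge 2$) of $G$ is a regular $m$-partite graph $\Gamma$ such that $\mathrm{Aut}(\Gamma)$ is isomorphic to $G$ and acts semiregularly on the vertex set with orbits giving the $m$-partition. An $m$-partite graphical semiregular representation ($m$-PGSR) of $G$ is an $m$-Cayley graph $\Gamma$ of $G$, not necessarily regular, with $T_{i,i}=\emptyset$ for all $i$ and $\mathrm{Aut}(\Gamma)\cong G$. Lemma 6.1. Let $G$ be a finite group with $d(G)=t\ge 4$, and let $\{h_1,\dots,h_t\}$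 be a generating set of $G$ such that $|h_1|\ge 3$ whenever $G$ is not an elementary abelian $2$-group. Put $$S=\{1,h_i\mid 1\le i\le t\},\qquad L=\{1,h_1,h_2h_1^{-1},h_i\mid 3\le i\le t\},\qquad R=\{1,h_1,h_ih_{i-1}^{-1}\mid 2\le i\le t\},$$ $$M=\{1,h_i\mid 1\le i\le t-1\},\qquad N=\{h_1h_2h_3h_4,\ h_1h_3h_4,\ h_2h_3h_4,\ h_ih_2h_1^{-1}\mid 3\le i\le t\}.$$ Let $\Gamma_4=\mathrm{Cay}(G,(T_{i,j})_{4\times4})$ with $T_{i,i}=\emptyset$, $T_{1,2}=T_{1,4}=T_{3,4}=S$, $T_{1,3}=L$, $T_{2,3}=R$ and $T_{2,4}=N$, and let $\Sigma_4=\mathrm{Cay}(G,(T_{i,j})_{4\times4})$ with $T_{i,i}=\emptyset$, $T_{1,2}=T_{1,4}=S$, $T_{1,3}=L$, $T_{2,3}=R$, $T_{2,4}=N$ and $T_{3,4}=M$. Then $\Gamma_4$ is a $4$-HGR of $G$. Moreover, $\Sigma_4$ is a $4$-PGSR of $G$ such that, for some integer $k$ with $2\le k\le |G|$: (a) the vertices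 $(g,1)$ and $(g,2)$ of $\Sigma_4$ have valency $k+1$ for each $g\in G$; (b) the vertices $(g,3)$ and $(g,4)$ of $\Sigma_4$ have valency $k$ for each $g\in G$; (c) there exists a $3$-cycle in $\Sigma_4$ through $(g,i)$ for each $g\in G$ and $i\in\{1,2,3,4\}$. -/

import Mathlib

open scoped Pointwise

/-- The valency of a vertex (all graphs considered are finite). -/
noncomputable def valency {V : Type*} (Γ : SimpleGraph V) (v : V) : ℕ :=
  (Γ.neighborSet v).ncard

/-- There is a cycle of length three through the vertex `v`. -/
def HasThreeCycleAt {V : Type*} (Γ : SimpleGraph V) (v : V) : Prop :=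
  ∃ p : Γ.Walk v v, p.IsCycle ∧ p.length = 3

/-- An `m × m` connection matrix over a group `G`: subsets `T i j` of `G` such that `1 ∉ T i i`
and `T j i` is the set of inverses of the elements of `T i j`. The index set `{1, …, m}` is
represented by `Fin m = {0, …, m - 1}`. -/
structure ConnectionMatrix (G : Type*) [Group G] (m : ℕ) where
  T : Fin m → Fin m → Set G
  one_notMem : ∀ i, (1 : G) ∉ T i i
  inv_eq : ∀ i j, T j i = (T i j)⁻¹

namespace ConnectionMatrix

variable {G : Type*} [Group G] {m : ℕ}

/-- The `m`-Cayley graph of `G` with connection matrix `C`: its vertices are the pairs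
`g_i = (g, i)`, and its edges are the pairs `{g_i, (t g)_j}` with `t ∈ T i j`. -/
def cay (C : ConnectionMatrix G m) : SimpleGraph (G × Fin m) where
  Adj u v := ∃ t ∈ C.T u.2 v.2, v.1 = t * u.1
  symm := ⟨by
    rintro ⟨g, i⟩ ⟨h, j⟩ ⟨t, ht, hth⟩
    refine ⟨t⁻¹, ?_, ?_⟩
    · rw [C.inv_eq i j]
      simpa using ht
    · simp only at hth ⊢
      rw [hth, inv_mul_cancel_left]⟩
  loopless := ⟨by
    rintro ⟨g, i⟩ ⟨t, ht, hth⟩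
    have h1 : t = 1 := by simpa using hth.symm
    exact C.one_notMem i (h1 ▸ ht)⟩

/-- The connection matrix with empty diagonal entries whose entries above the diagonal are those
of `T`. The entries below the diagonal are then determined; the entries of `T` on and below the
diagonal are not used. -/
def ofUpper (T : Fin m → Fin m → Set G) : ConnectionMatrix G m where
  T i j := if i < j then T i j else if j < i then (T j i)⁻¹ else ∅
  one_notMem i := by simp
  inv_eq i j := by
    rcases lt_trichotomy i j with h | h | h
    · simp [h, h.not_gt]
    · simp [h]
    · simp [h, h.not_gt]

/-- The `m`-Cayley graph with connection matrix `C` is an `m`-partite graphical semiregular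
representation (`m`-PGSR) of `G`: all diagonal entries of `C` are empty and the automorphism
group of the graph is isomorphic to `G`. -/
def IsPGSR (C : ConnectionMatrix G m) : Prop :=
  (∀ i, C.T i i = ∅) ∧ Nonempty ((C.cay ≃g C.cay) ≃* G)

end ConnectionMatrix

/-- The graph `Γ` is an `m`-Haar graphical representation (`m`-HGR) of the group `G`: it is
regular and `m`-partite, its automorphism group is isomorphic to `G` and acts semiregularly on the
vertices, and the orbits of this action are the `m` parts. -/
structure IsHGR (m : ℕ) (G : Type*) [Group G] {V : Type*} (Γ : SimpleGraph V) : Prop where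
  two_le : 2 ≤ m
  regular : ∃ r : ℕ, ∀ v, valency Γ v = r
  aut_iso : Nonempty ((Γ ≃g Γ) ≃* G)
  semiregular : ∀ v : V, MulAction.stabilizer (Γ ≃g Γ) v = ⊥
  card_orbits : Nat.card (MulAction.orbitRel.Quotient (Γ ≃g Γ) V) = m
  orbits_independent : ∀ u v : V, Γ.Adj u v → v ∉ MulAction.orbit (Γ ≃g Γ) u

/-- The valency and `3`-cycle conditions on a graph with vertex set `G × {1, 2, 3, 4}`. -/
def ValencyCycleConditions {G : Type*} (Γ : SimpleGraph (G × Fin 4)) : Prop :=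
  ∃ k : ℕ, 2 ≤ k ∧ k ≤ Nat.card G ∧
    (∀ g : G, valency Γ (g, 0) = k + 1 ∧ valency Γ (g, 1) = k + 1) ∧
    (∀ g : G, valency Γ (g, 2) = k ∧ valency Γ (g, 3) = k) ∧
    (∀ (g : G) (i : Fin 4), HasThreeCycleAt Γ (g, i))

section Sets

variable {G : Type*} [Group G]

/-! The connection sets attached to elements `h 1, …, h t` of `G` (the other values of `h` are
not used, provided that `4 ≤ t`). -/

/-- `S = {1, h_i | 1 ≤ i ≤ t}`. -/
def setS (t : ℕ) (h : ℕ → G) : Set G := {1} ∪ h '' Set.Icc 1 t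

/-- `L = {1, h_1, h_2 h_1⁻¹, h_i | 3 ≤ i ≤ t}`. -/
def setL (t : ℕ) (h : ℕ → G) : Set G := {1, h 1, h 2 * (h 1)⁻¹} ∪ h '' Set.Icc 3 t

/-- `R = {1, h_1, h_i h_{i-1}⁻¹ | 2 ≤ i ≤ t}`. -/
def setR (t : ℕ) (h : ℕ → G) : Set G :=
  {1, h 1} ∪ (fun i => h i * (h (i - 1))⁻¹) '' Set.Icc 2 t

/-- `M = {1, h_i | 1 ≤ i ≤ t - 1}`. -/
def setM (t : ℕ) (h : ℕ → G) : Set G := {1} ∪ h '' Set.Icc 1 (t - 1)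

/-- `N = {h_1 h_2 h_3 h_4, h_1 h_3 h_4, h_2 h_3 h_4, h_i h_2 h_1⁻¹ | 3 ≤ i ≤ t}`. -/
def setN (t : ℕ) (h : ℕ → G) : Set G :=
  {h 1 * h 2 * h 3 * h 4, h 1 * h 3 * h 4, h 2 * h 3 * h 4} ∪
    (fun i => h i * h 2 * (h 1)⁻¹) '' Set.Icc 3 t

/-- The connection matrix of the graph `Γ₄`. -/
def gammaFour (t : ℕ) (h : ℕ → G) : ConnectionMatrix G 4 :=
  .ofUpper ![![∅, setS t h, setL t h, setS t h],
             ![∅, ∅,        setR t h, setN t h],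
             ![∅, ∅,        ∅,        setS t h],
             ![∅, ∅,        ∅,        ∅       ]]

/-- The connection matrix of the graph `Σ₄`. -/
def sigmaFour (t : ℕ) (h : ℕ → G) : ConnectionMatrix G 4 :=
  .ofUpper ![![∅, setS t h, setL t h, setS t h],
             ![∅, ∅,        setR t h, setN t h],
             ![∅, ∅,        ∅,        setM t h],
             ![∅, ∅,        ∅,        ∅       ]]

end Sets

/-!
The elements `h 1, …, h t` generate a group of rank `t`, so no `h k` lies in the subgroup generated
by the others. Hence an equation between words in the `h i` is false as soon as some generator
occurs exactly once in it. This criterion (`IsIndepSeq.index_eq_of_mul_eq_one_cyclic`) decides all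
the questions about the sets `S`, `L`, `R`, `M`, `N` below.

Both graphs have the form `quadMatrix t h W` with `M ⊆ W ⊆ S`, with parts indexed by `0, 1, 2, 3`.
It suffices that every automorphism `φ` is a right translation `(g, i) ↦ (g * c, i)`.

*The parts are preserved.* The elements of `N` involve three generators and those of `S * S⁻¹` at
most two, so there are no triangles through the parts `0, 1, 3`. Since `h 1 * h 2 * h 3 * h 4` is
not in `S * R`, each vertex of the parts `1` and `3` is on an edge that lies in no triangle, while
all edges at the parts `0` and `2` lie in triangles. Moreover `2`, but not `0`, has triangles with
two vertices in `1 ∪ 3`. To separate `1` from `3`, compare valencies in `Σ₄`. In `Γ₄` the edges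
from `(g, 0)` to `(g, 2)` are the only ones between these parts with at least six common
neighbours; a vertex of part `3` adjacent to one end is adjacent to the other, which fails in
part `1`.

*Automorphisms preserving the parts are translations* (`IsIndepSeq.isRigid_quadMatrix`). Counting
common neighbours shows that `φ` acts on the first coordinates in the parts `0`, `1`, `2` by one
permutation `f` of `G`, which therefore respects `S`, `L` and `R`. From `S ∩ R = {1, h 1}`,
`L \ S = {h 2 * (h 1)⁻¹}` and the chain of elements `h i * (h (i - 1))⁻¹` of `R` it follows that
`f` commutes with the left translations by all `h i` (`IsIndepSeq.eq_mul_of_preserves`), so that `f` is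
a right translation. The part `3` follows, because `w * S ⊆ S` only for `w = 1`.
-/

/-! ### Sequences of independent generators -/

/-- The elements `h 1, …, h t` are independent: for each `k` some subgroup contains all of them
except `h k`. The value `h 0` is normalized to be `1`, so that `S = {h 0, …, h t}` and
`h 1 = h 1 * (h 0)⁻¹` can be treated like the other elements of `R`. -/
structure IsIndepSeq {G : Type*} [Group G] (t : ℕ) (h : ℕ → G) : Prop where
  zero : h 0 = 1
  exists_subgroup : ∀ k, 1 ≤ k → k ≤ t →
    ∃ K : Subgroup G, h k ∉ K ∧ ∀ i, i ≤ t → i ≠ k → h i ∈ K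

section Words

variable {G : Type*} [Group G] {t : ℕ} {h : ℕ → G}

/-- A generating sequence whose length is the rank is independent: the generators other than
`h k` are too few to generate the group. -/
theorem isIndepSeq_update_zero [Finite G] (hd : Group.rank G = t)
    (hgen : Subgroup.closure (h '' Set.Icc 1 t) = ⊤) :
    IsIndepSeq t (Function.update h 0 1) := by
  classical
  refine ⟨by simp, fun k hk1 hkt => ?_⟩
  have hupd : ∀ i, i ≠ 0 → Function.update h 0 1 i = h i := fun i hi =>
    Function.update_of_ne hi _ _
  refine ⟨Subgroup.closure (h '' (Set.Icc 1 t \ {k})), ?_, ?_⟩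
  · rw [hupd k (by omega)]
    intro hmem
    have htop : Subgroup.closure (h '' (Set.Icc 1 t \ {k})) = ⊤ := by
      rw [eq_top_iff, ← hgen, Subgroup.closure_le]
      rintro _ ⟨i, hi, rfl⟩
      by_cases hik : i = k
      · exact hik ▸ hmem
      · exact Subgroup.subset_closure ⟨i, ⟨hi, hik⟩, rfl⟩
    have hfin : (((Finset.Icc 1 t).erase k).image h : Set G) = h '' (Set.Icc 1 t \ {k}) := by
      simp
    rw [← hfin] at htop
    have h1 := Group.rank_le htop
    have h2 : (((Finset.Icc 1 t).erase k).image h).card ≤ _ := Finset.card_image_le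
    rw [Finset.card_erase_of_mem (by simp; omega), Nat.card_Icc] at h2
    omega
  · intro i hi hik
    by_cases h0 : i = 0
    · subst h0
      simp
    · rw [hupd i h0]
      exact Subgroup.subset_closure ⟨i, ⟨⟨by omega, hi⟩, hik⟩, rfl⟩

namespace IsIndepSeq

/-- In a relation of length five between independent elements and their inverses, the first
letter, unless trivial, occurs once more. -/
theorem index_eq_of_mul_eq_one (H : IsIndepSeq t h) {a b c d e : ℕ} {x y z u v : G}
    (ha : a ≤ t) (hb : b ≤ t) (hc : c ≤ t) (hd : d ≤ t) (he : e ≤ t)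
    (hx : ∀ K : Subgroup G, x ∈ K ↔ h a ∈ K) (hy : ∀ K : Subgroup G, y ∈ K ↔ h b ∈ K)
    (hz : ∀ K : Subgroup G, z ∈ K ↔ h c ∈ K) (hu : ∀ K : Subgroup G, u ∈ K ↔ h d ∈ K)
    (hv : ∀ K : Subgroup G, v ∈ K ↔ h e ∈ K)
    (hw : x * y * z * u * v = 1) : a = 0 ∨ a = b ∨ a = c ∨ a = d ∨ a = e := by
  by_contra! hne
  obtain ⟨K, hK, hmem⟩ := H.exists_subgroup a (by omega) ha
  have hy' := (hy K).2 (hmem b hb (by omega))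
  have hz' := (hz K).2 (hmem c hc (by omega))
  have hu' := (hu K).2 (hmem d hd (by omega))
  have hv' := (hv K).2 (hmem e he (by omega))
  apply hK
  rw [← hx K]
  have h1 : x * y * z * u * v ∈ K := hw ▸ K.one_mem
  rwa [K.mul_mem_cancel_right hv', K.mul_mem_cancel_right hu', K.mul_mem_cancel_right hz',
    K.mul_mem_cancel_right hy'] at h1

/-- In a relation of length five between independent elements and their inverses, no nontrivial
letter occurs exactly once. -/
theorem index_eq_of_mul_eq_one_cyclic (H : IsIndepSeq t h) {a b c d e : ℕ} {x y z u v : G}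
    (ha : a ≤ t) (hb : b ≤ t) (hc : c ≤ t) (hd : d ≤ t) (he : e ≤ t)
    (hx : ∀ K : Subgroup G, x ∈ K ↔ h a ∈ K) (hy : ∀ K : Subgroup G, y ∈ K ↔ h b ∈ K)
    (hz : ∀ K : Subgroup G, z ∈ K ↔ h c ∈ K) (hu : ∀ K : Subgroup G, u ∈ K ↔ h d ∈ K)
    (hv : ∀ K : Subgroup G, v ∈ K ↔ h e ∈ K)
    (hw : x * y * z * u * v = 1) :
    (a = 0 ∨ a = b ∨ a = c ∨ a = d ∨ a = e) ∧ (b = 0 ∨ b = c ∨ b = d ∨ b = e ∨ b = a) ∧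
    (c = 0 ∨ c = d ∨ c = e ∨ c = a ∨ c = b) ∧ (d = 0 ∨ d = e ∨ d = a ∨ d = b ∨ d = c) ∧
    (e = 0 ∨ e = a ∨ e = b ∨ e = c ∨ e = d) := by
  have rot : ∀ {x y z u v : G}, x * y * z * u * v = 1 → y * z * u * v * x = 1 := by
    intro x y z u v hw
    have h1 : y * z * u * v = x⁻¹ :=
      eq_inv_of_mul_eq_one_right (by simpa only [mul_assoc] using hw)
    rw [h1, inv_mul_cancel]
  have h2 := rot hw
  have h3 := rot h2
  have h4 := rot h3
  have h5 := rot h4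
  exact ⟨H.index_eq_of_mul_eq_one ha hb hc hd he hx hy hz hu hv hw,
    H.index_eq_of_mul_eq_one hb hc hd he ha hy hz hu hv hx h2,
    H.index_eq_of_mul_eq_one hc hd he ha hb hz hu hv hx hy h3,
    H.index_eq_of_mul_eq_one hd he ha hb hc hu hv hx hy hz h4,
    H.index_eq_of_mul_eq_one he ha hb hc hd hv hx hy hz hu h5⟩

/-- The relations `h a * (h b)⁻¹ * h c = h d * (h e)⁻¹`, in which no nontrivial letter occurs
exactly once. -/
theorem index_eq_of_eq (H : IsIndepSeq t h) {a b c d e : ℕ}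
    (ha : a ≤ t) (hb : b ≤ t) (hc : c ≤ t) (hd : d ≤ t) (he : e ≤ t)
    (hw : h a * (h b)⁻¹ * h c = h d * (h e)⁻¹) :
    (a = 0 ∨ a = b ∨ a = c ∨ a = e ∨ a = d) ∧ (b = 0 ∨ b = c ∨ b = e ∨ b = d ∨ b = a) ∧
    (c = 0 ∨ c = e ∨ c = d ∨ c = a ∨ c = b) ∧ (e = 0 ∨ e = d ∨ e = a ∨ e = b ∨ e = c) ∧
    (d = 0 ∨ d = a ∨ d = b ∨ d = c ∨ d = e) :=
  H.index_eq_of_mul_eq_one_cyclic ha hb hc he hd (x := h a) (y := (h b)⁻¹) (z := h c)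
    (u := h e) (v := (h d)⁻¹) (fun _ => Iff.rfl) (fun _ => inv_mem_iff) (fun _ => Iff.rfl)
    (fun _ => Iff.rfl) (fun _ => inv_mem_iff) (by rw [hw]; group)

theorem injOn (H : IsIndepSeq t h) {i j : ℕ} (hi : i ≤ t) (hj : j ≤ t) (hij : h i = h j) :
    i = j := by
  have := H.index_eq_of_eq (a := i) (b := 0) (c := 0) (d := j) (e := 0) hi (by omega) (by omega)
    hj (by omega) (by simp [H.zero, hij])
  omega

end IsIndepSeq
end Words

/-! ### The connection sets -/

namespace IsIndepSeq

variable {G : Type*} [Group G] {t : ℕ} {h : ℕ → G}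

theorem mem_setS (H : IsIndepSeq t h) {x : G} : x ∈ setS t h ↔ ∃ i ≤ t, x = h i := by
  constructor
  · rintro (rfl | ⟨i, hi, rfl⟩)
    · exact ⟨0, by omega, H.zero.symm⟩
    · exact ⟨i, hi.2, rfl⟩
  · rintro ⟨i, hi, rfl⟩
    by_cases h0 : i = 0
    · exact Or.inl (by rw [h0, H.zero]; rfl)
    · exact Or.inr ⟨i, ⟨by omega, hi⟩, rfl⟩

theorem mem_setM (H : IsIndepSeq t h) {x : G} : x ∈ setM t h ↔ ∃ i ≤ t - 1, x = h i := by
  constructor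
  · rintro (rfl | ⟨i, hi, rfl⟩)
    · exact ⟨0, by omega, H.zero.symm⟩
    · exact ⟨i, hi.2, rfl⟩
  · rintro ⟨i, hi, rfl⟩
    by_cases h0 : i = 0
    · exact Or.inl (by rw [h0, H.zero]; rfl)
    · exact Or.inr ⟨i, ⟨by omega, hi⟩, rfl⟩

theorem mem_setL (H : IsIndepSeq t h) (ht : 1 ≤ t) {x : G} :
    x ∈ setL t h ↔ x = h 2 * (h 1)⁻¹ ∨ ∃ i ≤ t, i ≠ 2 ∧ x = h i := by
  constructor
  · rintro ((rfl | rfl | rfl) | ⟨i, hi, rfl⟩)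
    · exact Or.inr ⟨0, by omega, by omega, H.zero.symm⟩
    · exact Or.inr ⟨1, by omega, by omega, rfl⟩
    · exact Or.inl rfl
    · exact Or.inr ⟨i, hi.2, by have := hi.1; omega, rfl⟩
  · rintro (rfl | ⟨i, hi, hi2, rfl⟩)
    · simp [setL]
    · by_cases h0 : i = 0
      · simp [setL, h0, H.zero]
      · by_cases h1 : i = 1
        · simp [setL, h1]
        · exact Or.inr ⟨i, ⟨by omega, hi⟩, rfl⟩

theorem mem_setR (H : IsIndepSeq t h) (ht : 1 ≤ t) {x : G} :
    x ∈ setR t h ↔ x = 1 ∨ ∃ i, 1 ≤ i ∧ i ≤ t ∧ x = h i * (h (i - 1))⁻¹ := by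
  constructor
  · rintro ((rfl | rfl) | ⟨i, hi, rfl⟩)
    · exact Or.inl rfl
    · exact Or.inr ⟨1, le_rfl, ht, by simp [H.zero]⟩
    · exact Or.inr ⟨i, by have := hi.1; omega, hi.2, rfl⟩
  · rintro (rfl | ⟨i, hi1, hi, rfl⟩)
    · simp [setR]
    · by_cases h1 : i = 1
      · simp [setR, h1, H.zero]
      · exact Or.inr ⟨i, ⟨by omega, hi⟩, rfl⟩

theorem mem_setN {x : G} : x ∈ setN t h ↔ x = h 1 * h 2 * h 3 * h 4 ∨ x = h 1 * h 3 * h 4 ∨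
    x = h 2 * h 3 * h 4 ∨ ∃ i, 3 ≤ i ∧ i ≤ t ∧ x = h i * h 2 * (h 1)⁻¹ := by
  simp only [setN, Set.mem_union, Set.mem_insert_iff, Set.mem_singleton_iff, Set.mem_image,
    Set.mem_Icc, or_assoc, and_assoc, eq_comm]

theorem setM_subset_setS : setM t h ⊆ setS t h :=
  Set.union_subset_union_right _ (Set.image_mono (Set.Icc_subset_Icc_right (by omega)))

theorem apply_mem_setS (H : IsIndepSeq t h) {i : ℕ} (hi : i ≤ t) : h i ∈ setS t h :=
  H.mem_setS.2 ⟨i, hi, rfl⟩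

theorem apply_mem_setM (H : IsIndepSeq t h) {i : ℕ} (hi : i ≤ t - 1) : h i ∈ setM t h :=
  H.mem_setM.2 ⟨i, hi, rfl⟩

theorem apply_mem_setL (H : IsIndepSeq t h) (ht : 1 ≤ t) {i : ℕ} (hi : i ≤ t) (hi2 : i ≠ 2) :
    h i ∈ setL t h :=
  (H.mem_setL ht).2 (Or.inr ⟨i, hi, hi2, rfl⟩)

theorem one_mem_setS : (1 : G) ∈ setS t h := by simp [setS]

theorem one_mem_setM : (1 : G) ∈ setM t h := by simp [setM]

theorem one_mem_setL : (1 : G) ∈ setL t h := by simp [setL]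

theorem one_mem_setR : (1 : G) ∈ setR t h := by simp [setR]

theorem apply_one_mem_setR : h 1 ∈ setR t h := by simp [setR]

theorem div_mem_setR (H : IsIndepSeq t h) {i : ℕ} (hi : 1 ≤ i) (hit : i ≤ t) :
    h i * (h (i - 1))⁻¹ ∈ setR t h :=
  (H.mem_setR (by omega)).2 (Or.inr ⟨i, hi, hit, rfl⟩)

/-- The elements `1` and `h 1` are the only common elements of `S` and `R`. -/
theorem eq_of_mem_setS_of_mem_setR (H : IsIndepSeq t h) (ht : 1 ≤ t) {x : G}
    (hS : x ∈ setS t h) (hR : x ∈ setR t h) : x = 1 ∨ x = h 1 := by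
  obtain ⟨i, hi, rfl⟩ := H.mem_setS.1 hS
  obtain h1 | ⟨j, hj1, hj, hij⟩ := (H.mem_setR ht).1 hR
  · exact Or.inl h1
  · have := H.index_eq_of_eq (a := i) (b := 0) (c := 0) hi (by omega) (by omega) hj
      (by omega : j - 1 ≤ t) (by simp [H.zero, hij])
    exact Or.inr (by congr 1; omega)

theorem div_notMem_setS (H : IsIndepSeq t h) (ht : 2 ≤ t) : h 2 * (h 1)⁻¹ ∉ setS t h := by
  intro hS
  obtain ⟨i, hi, hij⟩ := H.mem_setS.1 hS
  have := H.index_eq_of_eq (a := i) (b := 0) (c := 0) (d := 2) (e := 1) hi (by omega) (by omega)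
    (by omega) (by omega) (by simp [H.zero, hij])
  omega

/-- Left multiplication by an element of `R` moves the index of an element of `S` by at most
one, if the result is again in `S`. -/
theorem index_close_of_mul_eq (H : IsIndepSeq t h) (ht : 1 ≤ t) {i j : ℕ} {r : G} (hi : i ≤ t)
    (hj : j ≤ t) (hr : r ∈ setR t h) (hij : r * h j = h i) :
    i = j ∨ i = j + 1 ∨ j = i + 1 := by
  obtain rfl | ⟨k, hk1, hk, rfl⟩ := (H.mem_setR ht).1 hr
  · exact Or.inl (H.injOn hj hi (by simpa using hij)).symm
  · have := H.index_eq_of_eq (a := k) (b := k - 1) (c := j) (d := i) (e := 0) hk (by omega) hj hi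
      (by omega) (by simp [H.zero, hij])
    by_cases hjk : j = k - 1
    · subst hjk
      have := H.injOn hk hi (by simpa using hij)
      omega
    · by_cases hik : i = k
      · subst hik
        have h1 : (h (i - 1))⁻¹ * h j = 1 := by simpa [mul_assoc] using hij
        exact absurd (H.injOn hj (by omega) (inv_mul_eq_one.1 h1).symm) hjk
      · omega

/-- The vertices `(1, 0)` and `(l, 2)` with `l ≠ 1` have at most two common neighbours in the
fourth part. -/
theorem exists_pair_of_mul_inv_mem_setS (H : IsIndepSeq t h) (ht : 2 ≤ t) {l : G}
    (hl : l ∈ setL t h) (hl1 : l ≠ 1) :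
    ∃ p q : G, ∀ s ∈ setS t h, s * l⁻¹ ∈ setS t h → s = p ∨ s = q := by
  obtain rfl | ⟨i, hi, hi2, rfl⟩ := (H.mem_setL (by omega)).1 hl
  · refine ⟨h 1, h 2, fun s hs hsl => ?_⟩
    obtain ⟨j, hj, rfl⟩ := H.mem_setS.1 hs
    obtain ⟨k, hk, hjk⟩ := H.mem_setS.1 hsl
    have := H.index_eq_of_mul_eq_one_cyclic (a := k) (b := 2) (c := 1) (d := j) (e := 0) hk ht
      (by omega) hj (by omega) (x := h k) (y := h 2) (z := (h 1)⁻¹) (u := (h j)⁻¹) (v := h 0)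
      (fun _ => Iff.rfl) (fun _ => Iff.rfl) (fun _ => inv_mem_iff) (fun _ => inv_mem_iff)
      (fun _ => Iff.rfl) (by rw [← hjk, H.zero]; group)
    obtain h1 | h1 : j = 1 ∨ j = 2 := by omega
    · exact Or.inl (by rw [h1])
    · exact Or.inr (by rw [h1])
  · have hi0 : i ≠ 0 := by
      rintro rfl
      exact hl1 H.zero
    refine ⟨1, h i, fun s hs hsl => ?_⟩
    obtain ⟨j, hj, rfl⟩ := H.mem_setS.1 hs
    obtain ⟨k, hk, hjk⟩ := H.mem_setS.1 hsl
    have := H.index_eq_of_eq (a := j) (b := i) (c := 0) (d := k) (e := 0) hj hi (by omega) hk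
      (by omega) (by simp [H.zero, hjk])
    obtain h1 | h1 : j = 0 ∨ j = i := by omega
    · exact Or.inl (by rw [h1, H.zero])
    · exact Or.inr (by rw [h1])

/-- The vertices `(1, 0)` and `(l, 2)` have at most three common neighbours in the
second part. -/
theorem exists_triple_of_mul_inv_mem_setR (H : IsIndepSeq t h) (ht : 2 ≤ t) {l : G}
    (hl : l ∈ setL t h) :
    ∃ p q r : G, ∀ s ∈ setS t h, l * s⁻¹ ∈ setR t h → s = p ∨ s = q ∨ s = r := by
  obtain rfl | ⟨i, hi, hi2, rfl⟩ := (H.mem_setL (by omega)).1 hl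
  · refine ⟨h 0, h 2, h 2, fun s hs hsl => ?_⟩
    obtain ⟨j, hj, rfl⟩ := H.mem_setS.1 hs
    obtain h1 | ⟨k, hk1, hk, hjk⟩ := (H.mem_setR (by omega)).1 hsl
    · exact absurd (mul_inv_eq_one.1 h1 ▸ hs) (H.div_notMem_setS ht)
    · have := H.index_eq_of_eq (a := k) (b := k - 1) (c := j) (d := 2) (e := 1) hk (by omega) hj
        (by omega) (by omega) (by rw [← hjk]; group)
      by_cases hjk' : j = k - 1
      · subst hjk'
        exact absurd (H.mem_setS.2 ⟨k, hk, mul_right_cancel hjk⟩) (H.div_notMem_setS ht)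
      · obtain h1 | h1 : j = 0 ∨ j = 2 := by omega
        · exact Or.inl (by rw [h1])
        · exact Or.inr (Or.inl (by rw [h1]))
  · refine ⟨h i, h (i - 1), h (i + 1), fun s hs hsl => ?_⟩
    obtain ⟨j, hj, rfl⟩ := H.mem_setS.1 hs
    obtain h1 | h1 | h1 := H.index_close_of_mul_eq (by omega) hi hj hsl (by group)
    · exact Or.inl (by rw [h1])
    · exact Or.inr (Or.inl (by rw [h1]; rfl))
    · exact Or.inr (Or.inr (by rw [h1]))

/-- The vertices `(1, 0)` and `(h 1, 1)` have at most two common neighbours in the third part. -/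
theorem eq_of_mul_inv_mem_setR (H : IsIndepSeq t h) (ht : 2 ≤ t) {l : G} (hl : l ∈ setL t h)
    (hr : l * (h 1)⁻¹ ∈ setR t h) : l = h 1 ∨ l = h 1 * h 1 := by
  obtain h1 | ⟨k, hk1, hk, hlk⟩ := (H.mem_setR (by omega)).1 hr
  · exact Or.inl (mul_inv_eq_one.1 h1)
  · obtain rfl | hk2 := eq_or_lt_of_le hk1
    · exact Or.inr (by simpa [H.zero, mul_inv_eq_iff_eq_mul] using hlk)
    · exfalso
      obtain rfl | ⟨i, hi, hi2, rfl⟩ := (H.mem_setL (by omega)).1 hl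
      · have := H.index_eq_of_eq (a := k) (b := k - 1) (c := 1) (d := 2) (e := 1) hk (by omega)
          (by omega) (by omega) (by omega) (by rw [← hlk]; group)
        obtain rfl : k = 2 := by omega
        rw [mul_left_inj, mul_eq_left, inv_eq_one, ← H.zero] at hlk
        exact absurd (H.injOn (by omega) (by omega) hlk) (by omega)
      · have := H.index_eq_of_eq (a := k) (b := k - 1) (c := 1) (d := i) (e := 0) hk (by omega)
          (by omega) (by omega) (by omega) (by rw [← hlk, H.zero]; group)
        omega

/-- A product of three independent elements and their inverses is not `h 1 * h 2 * h 3 * h 4`. -/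
theorem mul_mul_mul_ne (H : IsIndepSeq t h) (ht : 4 ≤ t) {a b c : ℕ} (ha : a ≤ t) (hb : b ≤ t)
    (hc : c ≤ t) : h 1 * h 2 * h 3 * h 4 ≠ h a * (h b * (h c)⁻¹) := by
  intro heq
  -- one of the four generators is none of the three letters on the right
  obtain ⟨k, hk1, hk4, hka, hkb, hkc⟩ : ∃ k, 1 ≤ k ∧ k ≤ 4 ∧ k ≠ a ∧ k ≠ b ∧ k ≠ c := by
    obtain h1 | h1 | h1 | h1 : (1 ≠ a ∧ 1 ≠ b ∧ 1 ≠ c) ∨ (2 ≠ a ∧ 2 ≠ b ∧ 2 ≠ c) ∨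
      (3 ≠ a ∧ 3 ≠ b ∧ 3 ≠ c) ∨ (4 ≠ a ∧ 4 ≠ b ∧ 4 ≠ c) := by omega
    exacts [⟨1, by omega, by omega, h1⟩, ⟨2, by omega, by omega, h1⟩,
      ⟨3, by omega, by omega, h1⟩, ⟨4, by omega, by omega, h1⟩]
  obtain ⟨K, hK, hm⟩ := H.exists_subgroup k hk1 (by omega)
  have hmem : h 1 * h 2 * h 3 * h 4 ∈ K := heq ▸ K.mul_mem (hm a ha hka.symm)
    (K.mul_mem (hm b hb hkb.symm) (K.inv_mem (hm c hc hkc.symm)))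
  clear heq
  have m1 := hm 1 (by omega)
  have m2 := hm 2 (by omega)
  have m3 := hm 3 (by omega)
  have m4 := hm 4 (by omega)
  obtain rfl | rfl | rfl | rfl : k = 1 ∨ k = 2 ∨ k = 3 ∨ k = 4 := by omega
  all_goals simp_all [K.mul_mem_cancel_left, K.mul_mem_cancel_right]

/-- The elements of `N` involve at least three of the generators. -/
theorem div_notMem_setN (H : IsIndepSeq t h) (ht : 4 ≤ t) {i j : ℕ} (hi : i ≤ t)
    (hj : j ≤ t) : h i * (h j)⁻¹ ∉ setN t h := by
  have key : ∀ a b, a ≤ t → b ≤ t → a ≠ b → a ≠ 0 → b ≠ 0 → ∀ c, c ≤ t →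
      c ≠ 0 → c ≠ a → c ≠ b → ∀ x y : G, (∀ K : Subgroup G, x ∈ K ↔ h b ∈ K) →
      (∀ K : Subgroup G, y ∈ K ↔ h c ∈ K) → h i * (h j)⁻¹ ≠ h a * x * y := by
    intro a b ha hb hab ha0 hb0 c hc hc0 hca hcb x y hx hy he
    have := H.index_eq_of_mul_eq_one_cyclic (a := a) (b := b) (c := c) (d := j) (e := i) ha
      hb hc hj hi (x := h a) (y := x) (z := y) (u := h j) (v := (h i)⁻¹)
      (fun _ => Iff.rfl) hx hy (fun _ => Iff.rfl) (fun _ => inv_mem_iff) (by rw [← he]; group)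
    omega
  intro hN
  obtain h1 | h1 | h1 | ⟨a, ha3, ha, h1⟩ := mem_setN.1 hN
  · exact H.mul_mul_mul_ne ht (Nat.zero_le t) hi hj (by rw [← h1, H.zero, one_mul])
  · exact key 1 3 (by omega) (by omega) (by omega) (by omega) (by omega) 4 (by omega)
      (by omega) (by omega) (by omega) _ _ (fun _ => Iff.rfl) (fun _ => Iff.rfl) h1
  · exact key 2 3 (by omega) (by omega) (by omega) (by omega) (by omega) 4 (by omega)
      (by omega) (by omega) (by omega) _ _ (fun _ => Iff.rfl) (fun _ => Iff.rfl) h1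
  · exact key a 2 (by omega) (by omega) (by omega) (by omega) (by omega) 1 (by omega)
      (by omega) (by omega) (by omega) _ _ (fun _ => Iff.rfl) (fun _ => inv_mem_iff) h1

/-- The element `h 1 * h 2 * h 3 * h 4` of `N` is not in `S * R`: the corresponding edges between
the second and the fourth part lie in no triangle with a vertex of the third part. -/
theorem mul_mul_mul_ne_mul (H : IsIndepSeq t h) (ht : 4 ≤ t) {s r : G} (hs : s ∈ setS t h)
    (hr : r ∈ setR t h) : h 1 * h 2 * h 3 * h 4 ≠ s * r := by
  obtain ⟨j, hj, rfl⟩ := H.mem_setS.1 hs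
  obtain rfl | ⟨k, hk1, hk, rfl⟩ := (H.mem_setR (by omega)).1 hr
  · simpa [H.zero] using H.mul_mul_mul_ne ht hj (Nat.zero_le t) (Nat.zero_le t)
  · exact H.mul_mul_mul_ne ht hj hk (by omega)

theorem eq_one_of_mul_mem_setS (H : IsIndepSeq t h) (ht : 2 ≤ t) {w : G}
    (hw : ∀ s ∈ setS t h, w * s ∈ setS t h) : w = 1 := by
  obtain ⟨j, hj, hwj⟩ := H.mem_setS.1 (hw 1 one_mem_setS)
  obtain rfl : w = h j := by simpa using hwj
  by_contra hne
  have hj0 : j ≠ 0 := by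
    rintro rfl
    exact hne H.zero
  obtain ⟨i, hi1, hi2, hij⟩ : ∃ i, 1 ≤ i ∧ i ≤ 2 ∧ i ≠ j := by
    by_cases h1 : j = 1
    · exact ⟨2, by omega, by omega, by omega⟩
    · exact ⟨1, by omega, by omega, by omega⟩
  obtain ⟨k, hk, hjk⟩ := H.mem_setS.1 (hw (h i) (H.apply_mem_setS (by omega)))
  have := H.index_eq_of_eq (a := j) (b := 0) (c := i) (d := k) (e := 0) hj (by omega) (by omega)
    hk (by omega) (by simp [H.zero, hjk])
  omega

/-! ### Sizes of the connection sets -/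

theorem ncard_setS (H : IsIndepSeq t h) : (setS t h).ncard = t + 1 := by
  have h1 : setS t h = h '' (Finset.range (t + 1) : Set ℕ) := by
    ext x
    simp [H.mem_setS, eq_comm]
  rw [h1, Set.InjOn.ncard_image, Set.ncard_coe_finset, Finset.card_range]
  intro i hi j hj hij
  simp only [Finset.coe_range, Set.mem_Iio] at hi hj
  exact H.injOn (by omega) (by omega) hij

theorem ncard_setM (H : IsIndepSeq t h) (ht : 1 ≤ t) : (setM t h).ncard = t := by
  have h1 : setM t h = h '' (Finset.range t : Set ℕ) := by
    ext x
    simp only [H.mem_setM, Finset.coe_range, Set.mem_image, Set.mem_Iio]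
    exact ⟨fun ⟨i, hi, hx⟩ => ⟨i, by omega, hx.symm⟩, fun ⟨i, hi, hx⟩ => ⟨i, by omega, hx.symm⟩⟩
  rw [h1, Set.InjOn.ncard_image, Set.ncard_coe_finset, Finset.card_range]
  intro i hi j hj hij
  simp only [Finset.coe_range, Set.mem_Iio] at hi hj
  exact H.injOn (by omega) (by omega) hij

theorem ncard_setL (H : IsIndepSeq t h) (ht : 2 ≤ t) : (setL t h).ncard = t + 1 := by
  have h1 : setL t h = insert (h 2 * (h 1)⁻¹) (h '' ((Finset.range (t + 1)).erase 2 : Set ℕ)) := by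
    ext x
    rw [H.mem_setL (by omega)]
    simp only [Finset.coe_erase, Finset.coe_range, Set.mem_insert_iff, Set.mem_image, Set.mem_sdiff,
      Set.mem_Iio, Set.mem_singleton_iff, Nat.lt_succ_iff, and_assoc, eq_comm]
  have h2 : h 2 * (h 1)⁻¹ ∉ h '' ((Finset.range (t + 1)).erase 2 : Set ℕ) := by
    rintro ⟨i, hi, hx⟩
    simp only [Finset.coe_erase, Finset.coe_range, Set.mem_sdiff, Set.mem_Iio] at hi
    exact H.div_notMem_setS ht (hx ▸ H.apply_mem_setS (by omega))
  rw [h1, Set.ncard_insert_of_notMem h2 (Set.toFinite _), Set.InjOn.ncard_image,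
    Set.ncard_coe_finset, Finset.card_erase_of_mem (by simp; omega), Finset.card_range]
  · omega
  · intro i hi j hj hij
    simp only [Finset.coe_erase, Finset.coe_range, Set.mem_sdiff, Set.mem_Iio] at hi hj
    exact H.injOn (by omega) (by omega) hij

theorem ncard_setR (H : IsIndepSeq t h) (ht : 1 ≤ t) : (setR t h).ncard = t + 1 := by
  have h1 : setR t h =
      insert 1 ((fun i => h i * (h (i - 1))⁻¹) '' (Finset.Icc 1 t : Set ℕ)) := by
    ext x
    rw [H.mem_setR ht]
    simp only [Finset.coe_Icc, Set.mem_insert_iff, Set.mem_image, Set.mem_Icc, and_assoc, eq_comm]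
  have h2 : (1 : G) ∉ (fun i => h i * (h (i - 1))⁻¹) '' (Finset.Icc 1 t : Set ℕ) := by
    rintro ⟨i, hi, hx⟩
    simp only [Finset.coe_Icc, Set.mem_Icc] at hi
    have := H.injOn (by omega) (by omega) (mul_inv_eq_one.1 hx)
    omega
  rw [h1, Set.ncard_insert_of_notMem h2 (Set.toFinite _), Set.InjOn.ncard_image,
    Set.ncard_coe_finset, Nat.card_Icc]
  · omega
  · intro i hi j hj hij
    simp only [Finset.coe_Icc, Set.mem_Icc] at hi hj
    have := H.index_eq_of_eq (a := i) (b := i - 1) (c := 0) (d := j) (e := j - 1) hi.2 (by omega)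
      (by omega) hj.2 (by omega) (by simpa [H.zero] using hij)
    omega

theorem ncard_setN (H : IsIndepSeq t h) (ht : 4 ≤ t) : (setN t h).ncard = t + 1 := by
  have h1 : setN t h = insert (h 1 * h 2 * h 3 * h 4) (insert (h 1 * h 3 * h 4)
      (insert (h 2 * h 3 * h 4) ((fun i => h i * h 2 * (h 1)⁻¹) '' (Finset.Icc 3 t : Set ℕ)))) := by
    ext x
    rw [mem_setN]
    simp only [Finset.coe_Icc, Set.mem_insert_iff, Set.mem_image, Set.mem_Icc, and_assoc, eq_comm]
  have key : ∀ a, 3 ≤ a → a ≤ t → h a * h 2 * (h 1)⁻¹ ≠ h 1 * h 2 * h 3 * h 4 ∧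
      h a * h 2 * (h 1)⁻¹ ≠ h 1 * h 3 * h 4 ∧ h a * h 2 * (h 1)⁻¹ ≠ h 2 * h 3 * h 4 := by
    intro a ha3 ha
    obtain ⟨k, hk3, hk4, hka⟩ : ∃ k, 3 ≤ k ∧ k ≤ 4 ∧ k ≠ a := by
      by_cases h3 : a = 3
      · exact ⟨4, by omega, by omega, by omega⟩
      · exact ⟨3, by omega, by omega, by omega⟩
    obtain ⟨K, hK, hm⟩ := H.exists_subgroup k (by omega) (by omega)
    have m1 := hm 1 (by omega) (by omega)
    have m2 := hm 2 (by omega) (by omega)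
    have m3 := hm 3 (by omega)
    have m4 := hm 4 (by omega)
    have mem : h a * h 2 * (h 1)⁻¹ ∈ K :=
      K.mul_mem (K.mul_mem (hm a ha hka.symm) m2) (K.inv_mem m1)
    refine ⟨fun he => hK ?_, fun he => hK ?_, fun he => hK ?_⟩ <;> rw [he] at mem <;>
      obtain rfl | rfl : k = 3 ∨ k = 4 := by omega
    all_goals simp_all [K.mul_mem_cancel_left, K.mul_mem_cancel_right]
  have ne12 : h 1 * h 2 * h 3 * h 4 ≠ h 1 * h 3 * h 4 := by
    intro he
    rw [mul_left_inj, mul_left_inj, mul_eq_left, ← H.zero] at he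
    exact absurd (H.injOn (by omega) (by omega) he) (by omega)
  have ne13 : h 1 * h 2 * h 3 * h 4 ≠ h 2 * h 3 * h 4 := by
    intro he
    rw [mul_left_inj, mul_left_inj, mul_eq_right, ← H.zero] at he
    exact absurd (H.injOn (by omega) (by omega) he) (by omega)
  have ne23 : h 1 * h 3 * h 4 ≠ h 2 * h 3 * h 4 := by
    intro he
    rw [mul_left_inj, mul_left_inj] at he
    exact absurd (H.injOn (by omega) (by omega) he) (by omega)
  rw [h1, Set.ncard_insert_of_notMem _ (Set.toFinite _),
    Set.ncard_insert_of_notMem _ (Set.toFinite _), Set.ncard_insert_of_notMem _ (Set.toFinite _),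
    Set.InjOn.ncard_image, Set.ncard_coe_finset, Nat.card_Icc]
  · omega
  · intro i hi j hj hij
    simp only [Finset.coe_Icc, Set.mem_Icc] at hi hj
    exact H.injOn (by omega) (by omega) (by simpa using hij)
  · rintro ⟨a, ha, he⟩
    simp only [Finset.coe_Icc, Set.mem_Icc] at ha
    exact (key a ha.1 ha.2).2.2 he
  · rintro (he | ⟨a, ha, he⟩)
    · exact ne23 he
    · simp only [Finset.coe_Icc, Set.mem_Icc] at ha
      exact (key a ha.1 ha.2).2.1 he
  · rintro (he | he | ⟨a, ha, he⟩)
    · exact ne12 he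
    · exact ne13 he
    · simp only [Finset.coe_Icc, Set.mem_Icc] at ha
      exact (key a ha.1 ha.2).1 he

/-- The subgroups generated by the initial segments form a strictly increasing chain, so their
orders at least double at each step. -/
theorem two_pow_le_card_closure [Finite G] (H : IsIndepSeq t h) {n : ℕ} (hn : n ≤ t) :
    2 ^ n ≤ Nat.card (Subgroup.closure (h '' Set.Icc 1 n)) := by
  induction n with
  | zero => exact Nat.card_pos
  | succ n ih =>
    set A := Subgroup.closure (h '' Set.Icc 1 n)
    set B := Subgroup.closure (h '' Set.Icc 1 (n + 1))
    have hAB : A ≤ B :=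
      Subgroup.closure_mono (Set.image_mono (Set.Icc_subset_Icc_right (by omega)))
    have hne : Nat.card A ≠ Nat.card B := by
      intro hcard
      have hB : h (n + 1) ∈ B := Subgroup.subset_closure ⟨n + 1, ⟨by omega, le_rfl⟩, rfl⟩
      rw [← Subgroup.eq_of_le_of_card_ge hAB hcard.ge] at hB
      obtain ⟨K, hK, hm⟩ := H.exists_subgroup (n + 1) (by omega) hn
      refine hK ((Subgroup.closure_le K).2 ?_ hB)
      rintro _ ⟨i, hi, rfl⟩
      have := hi.2
      exact hm i (by omega) (by omega)
    obtain ⟨c, hc⟩ := Subgroup.card_dvd_of_le hAB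
    have hpos : 0 < Nat.card B := Nat.card_pos
    have hc2 : 2 ≤ c := by
      by_contra! hlt
      interval_cases c
      · omega
      · omega
    calc 2 ^ (n + 1) = 2 ^ n * 2 := pow_succ 2 n
      _ ≤ Nat.card A * c := Nat.mul_le_mul (ih (by omega)) hc2
      _ = Nat.card B := hc.symm

theorem three_mul_add_two_le_card [Finite G] (H : IsIndepSeq t h) (ht : 4 ≤ t) :
    3 * t + 2 ≤ Nat.card G := by
  have h1 : 3 * t + 2 ≤ 2 ^ t := by
    induction t, ht using Nat.le_induction with
    | base => norm_num
    | succ n hn ih =>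
      have hih := ih ⟨H.zero, fun k hk1 hk => by
        obtain ⟨K, hK, hm⟩ := H.exists_subgroup k hk1 (by omega)
        exact ⟨K, hK, fun i hi => hm i (by omega)⟩⟩
      rw [pow_succ]
      omega
  exact h1.trans ((H.two_pow_le_card_closure le_rfl).trans (Subgroup.card_le_card_group _))

end IsIndepSeq

/-! ### Cayley graphs whose automorphisms are the right translations -/

namespace ConnectionMatrix

variable {G : Type*} [Group G] {m : ℕ}

theorem cay_adj_iff (C : ConnectionMatrix G m) {g x : G} {i j : Fin m} :
    C.cay.Adj (g, i) (x, j) ↔ x * g⁻¹ ∈ C.T i j :=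
  ⟨fun ⟨s, hs, hx⟩ => by simpa [show x = s * g from hx] using hs,
    fun hs => ⟨x * g⁻¹, hs, by simp⟩⟩

/-- The automorphism `(g, i) ↦ (g * c, i)` of an `m`-Cayley graph. -/
def rightMul (C : ConnectionMatrix G m) (c : G) : C.cay ≃g C.cay where
  toEquiv := (Equiv.mulRight c).prodCongr (Equiv.refl (Fin m))
  map_rel_iff' := by
    rintro ⟨g, i⟩ ⟨x, j⟩
    simp [cay_adj_iff]

theorem rightMul_apply (C : ConnectionMatrix G m) (c : G) (v : G × Fin m) :
    C.rightMul c v = (v.1 * c, v.2) := rfl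

/-- The semiregular action of `G` on an `m`-Cayley graph by right translations. -/
def rightMulHom (C : ConnectionMatrix G m) : G →* (C.cay ≃g C.cay) where
  toFun c := C.rightMul c⁻¹
  map_one' := by
    ext v <;> simp [rightMul_apply]
  map_mul' a b := by
    ext v <;> simp [rightMul_apply, mul_assoc]

/-- Every automorphism of the `m`-Cayley graph is a right translation. -/
def IsRigid (C : ConnectionMatrix G m) : Prop :=
  ∀ φ : C.cay ≃g C.cay, ∃ c : G, ∀ v, φ v = (v.1 * c, v.2)

theorem IsRigid.nonempty_mulEquiv [NeZero m] {C : ConnectionMatrix G m} (hC : C.IsRigid) :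
    Nonempty ((C.cay ≃g C.cay) ≃* G) := by
  refine ⟨(MulEquiv.ofBijective C.rightMulHom ⟨fun a b hab => ?_, fun φ => ?_⟩).symm⟩
  · have h1 : C.rightMul a⁻¹ (1, 0) = C.rightMul b⁻¹ (1, 0) :=
      congrArg (fun φ : C.cay ≃g C.cay => φ (1, 0)) hab
    simpa [rightMul_apply] using h1
  · obtain ⟨c, hc⟩ := hC φ
    refine ⟨c⁻¹, RelIso.ext fun v => ?_⟩
    change C.rightMul (c⁻¹)⁻¹ v = φ v
    rw [hc, rightMul_apply, inv_inv]

theorem IsRigid.mem_orbit_iff {C : ConnectionMatrix G m} (hC : C.IsRigid) {u v : G × Fin m} :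
    v ∈ MulAction.orbit (C.cay ≃g C.cay) u ↔ v.2 = u.2 := by
  constructor
  · rintro ⟨φ, rfl⟩
    obtain ⟨c, hc⟩ := hC φ
    change (φ u).2 = u.2
    rw [hc]
  · intro huv
    refine ⟨C.rightMul (u.1⁻¹ * v.1), ?_⟩
    change C.rightMul (u.1⁻¹ * v.1) u = v
    rw [rightMul_apply, mul_inv_cancel_left, ← huv]

theorem IsRigid.isHGR {C : ConnectionMatrix G m} (hC : C.IsRigid) (hm : 2 ≤ m)
    (hT : ∀ i, C.T i i = ∅) (hreg : ∃ r : ℕ, ∀ v, valency C.cay v = r) : IsHGR m G C.cay := by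
  have : NeZero m := ⟨by omega⟩
  refine ⟨hm, hreg, hC.nonempty_mulEquiv, fun v => ?_, ?_, ?_⟩
  · rw [eq_bot_iff]
    intro φ hφ
    obtain ⟨c, hc⟩ := hC φ
    have h1 : φ v = v := hφ
    rw [hc] at h1
    obtain rfl : c = 1 := mul_eq_left.1 (congrArg Prod.fst h1)
    exact Subgroup.mem_bot.2 (RelIso.ext fun u => by simp [hc])
  · let p : MulAction.orbitRel.Quotient (C.cay ≃g C.cay) (G × Fin m) → Fin m :=
      Quotient.lift Prod.snd fun u v huv =>
        hC.mem_orbit_iff.1 (MulAction.orbitRel_apply.1 huv)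
    have hp : Function.Bijective p := by
      constructor
      · intro a b
        refine Quotient.inductionOn₂ a b fun u v huv => ?_
        exact Quotient.sound (MulAction.orbitRel_apply.2 (hC.mem_orbit_iff.2 huv))
      · exact fun i => ⟨Quotient.mk _ (1, i), rfl⟩
    rw [Nat.card_eq_of_bijective p hp, Nat.card_fin]
  · rintro ⟨g, i⟩ ⟨x, j⟩ hadj horb
    obtain rfl : j = i := hC.mem_orbit_iff.1 horb
    rw [cay_adj_iff, hT] at hadj
    exact hadj

theorem valency_cay [Finite G] (C : ConnectionMatrix G m) (g : G) (i : Fin m) :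
    valency C.cay (g, i) = ∑ j, (C.T i j).ncard := by
  have e : C.cay.neighborSet (g, i) ≃ Σ j, C.T i j :=
    { toFun := fun v => ⟨v.1.2, v.1.1 * g⁻¹, C.cay_adj_iff.1 v.2⟩
      invFun := fun v => ⟨(v.2.1 * g, v.1), C.cay_adj_iff.2 (by simp)⟩
      left_inv := fun v => by simp
      right_inv := fun v => by simp }
  rw [valency, ← Nat.card_coe_set_eq, Nat.card_congr e, Nat.card_sigma]
  simp only [Nat.card_coe_set_eq]

end ConnectionMatrix

theorem valency_apply {V : Type*} {Γ : SimpleGraph V} (φ : Γ ≃g Γ) (v : V) :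
    valency Γ (φ v) = valency Γ v := by
  rw [valency, valency, ← Nat.card_coe_set_eq, ← Nat.card_coe_set_eq]
  exact (Nat.card_congr (φ.mapNeighborSet v)).symm

theorem hasThreeCycleAt_of_adj {V : Type*} {Γ : SimpleGraph V} {u v w : V} (huv : Γ.Adj u v)
    (hvw : Γ.Adj v w) (huw : Γ.Adj u w) : HasThreeCycleAt Γ u := by
  refine ⟨.cons huv (.cons hvw (.cons huw.symm .nil)), ?_, rfl⟩
  rw [SimpleGraph.Walk.cons_isCycle_iff]
  simp [huv.ne, huv.ne', hvw.ne, huw.ne, huw.ne']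

/-- Every edge at the vertex `v` lies in a triangle. -/
def EdgesInTriangles {V : Type*} (Γ : SimpleGraph V) (v : V) : Prop :=
  ∀ w, Γ.Adj v w → ∃ x, Γ.Adj v x ∧ Γ.Adj w x

theorem EdgesInTriangles.apply {V : Type*} {Γ : SimpleGraph V} {v : V} (hv : EdgesInTriangles Γ v)
    (φ : Γ ≃g Γ) : EdgesInTriangles Γ (φ v) := by
  intro w hw
  obtain ⟨w, rfl⟩ := φ.surjective w
  obtain ⟨x, hvx, hwx⟩ := hv w (φ.map_adj_iff.1 hw)
  exact ⟨φ x, φ.map_adj_iff.2 hvx, φ.map_adj_iff.2 hwx⟩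

theorem edgesInTriangles_apply_iff {V : Type*} {Γ : SimpleGraph V} {v : V} (φ : Γ ≃g Γ) :
    EdgesInTriangles Γ (φ v) ↔ EdgesInTriangles Γ v :=
  ⟨fun hv => by simpa using hv.apply φ.symm, fun hv => hv.apply φ⟩

/-- The vertex `v` lies in a triangle whose two other vertices are each on an edge that lies in no
triangle. -/
def InSparseTriangle {V : Type*} (Γ : SimpleGraph V) (v : V) : Prop :=
  ∃ x y, Γ.Adj v x ∧ Γ.Adj v y ∧ Γ.Adj x y ∧ ¬ EdgesInTriangles Γ x ∧ ¬ EdgesInTriangles Γ y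

theorem InSparseTriangle.apply {V : Type*} {Γ : SimpleGraph V} {v : V} (hv : InSparseTriangle Γ v)
    (φ : Γ ≃g Γ) : InSparseTriangle Γ (φ v) := by
  obtain ⟨x, y, h1, h2, h3, hx, hy⟩ := hv
  exact ⟨φ x, φ y, φ.map_adj_iff.2 h1, φ.map_adj_iff.2 h2, φ.map_adj_iff.2 h3,
    (edgesInTriangles_apply_iff φ).not.2 hx, (edgesInTriangles_apply_iff φ).not.2 hy⟩

theorem inSparseTriangle_apply_iff {V : Type*} {Γ : SimpleGraph V} {v : V} (φ : Γ ≃g Γ) :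
    InSparseTriangle Γ (φ v) ↔ InSparseTriangle Γ v :=
  ⟨fun hv => by simpa using hv.apply φ.symm, fun hv => hv.apply φ⟩

/-! ### The parts of `Γ₄` and `Σ₄` -/

section Quad

variable {G : Type*} [Group G] {t : ℕ} {h : ℕ → G} {W : Set G}

/-- The common form of the connection matrices of `Γ₄` and `Σ₄`: the entry between the last
two parts is a set `W`, equal to `S` or `M`. The four parts have the indices `0, 1, 2, 3`. -/
def quadMatrix (t : ℕ) (h : ℕ → G) (W : Set G) : ConnectionMatrix G 4 :=
  .ofUpper ![![∅, setS t h, setL t h, setS t h],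
             ![∅, ∅,        setR t h, setN t h],
             ![∅, ∅,        ∅,        W],
             ![∅, ∅,        ∅,        ∅       ]]

theorem quadMatrix_T_self (i : Fin 4) : (quadMatrix t h W).T i i = ∅ := by
  simp [quadMatrix, ConnectionMatrix.ofUpper]

theorem not_adj_same_part {g x : G} {i : Fin 4} : ¬ (quadMatrix t h W).cay.Adj (g, i) (x, i) := by
  rw [ConnectionMatrix.cay_adj_iff, quadMatrix_T_self]
  exact Set.notMem_empty _

theorem adj_zero_one {g x : G} :
    (quadMatrix t h W).cay.Adj (g, 0) (x, 1) ↔ x * g⁻¹ ∈ setS t h := by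
  simp [ConnectionMatrix.cay_adj_iff, quadMatrix, ConnectionMatrix.ofUpper]

theorem adj_zero_two {g x : G} :
    (quadMatrix t h W).cay.Adj (g, 0) (x, 2) ↔ x * g⁻¹ ∈ setL t h := by
  simp [ConnectionMatrix.cay_adj_iff, quadMatrix, ConnectionMatrix.ofUpper]

theorem adj_zero_three {g x : G} :
    (quadMatrix t h W).cay.Adj (g, 0) (x, 3) ↔ x * g⁻¹ ∈ setS t h := by
  simp [ConnectionMatrix.cay_adj_iff, quadMatrix, ConnectionMatrix.ofUpper]

theorem adj_one_two {g x : G} :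
    (quadMatrix t h W).cay.Adj (g, 1) (x, 2) ↔ x * g⁻¹ ∈ setR t h := by
  simp [ConnectionMatrix.cay_adj_iff, quadMatrix, ConnectionMatrix.ofUpper]

theorem adj_one_three {g x : G} :
    (quadMatrix t h W).cay.Adj (g, 1) (x, 3) ↔ x * g⁻¹ ∈ setN t h := by
  simp [ConnectionMatrix.cay_adj_iff, quadMatrix, ConnectionMatrix.ofUpper]

theorem adj_two_three {g x : G} :
    (quadMatrix t h W).cay.Adj (g, 2) (x, 3) ↔ x * g⁻¹ ∈ W := by
  simp [ConnectionMatrix.cay_adj_iff, quadMatrix, ConnectionMatrix.ofUpper]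

namespace IsIndepSeq

theorem edgesInTriangles_zero (H : IsIndepSeq t h) (ht : 4 ≤ t) (hMW : setM t h ⊆ W) (g : G) :
    EdgesInTriangles (quadMatrix t h W).cay (g, 0) := by
  rintro ⟨x, j⟩ hadj
  fin_cases j
  · exact absurd hadj not_adj_same_part
  · obtain ⟨i, hi, hx⟩ := H.mem_setS.1 (adj_zero_one.1 hadj)
    obtain rfl := mul_inv_eq_iff_eq_mul.1 hx
    by_cases hi2 : i = 2
    · subst hi2
      refine ⟨(h 3 * g, 2), adj_zero_two.2 ?_, adj_one_two.2 ?_⟩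
      · simpa using H.apply_mem_setL (i := 3) (by omega) (by omega) (by omega)
      · simpa [mul_assoc] using H.div_mem_setR (i := 3) (by omega) (by omega)
    · refine ⟨(h i * g, 2), adj_zero_two.2 ?_, adj_one_two.2 ?_⟩
      · simpa using H.apply_mem_setL (by omega) hi hi2
      · simpa using one_mem_setR
  · have hl := adj_zero_two.1 hadj
    obtain hx | ⟨i, hi, hi2, hx⟩ := (H.mem_setL (by omega)).1 hl
    · refine ⟨(g, 1), adj_zero_one.2 (by simpa using one_mem_setS), (adj_one_two.2 ?_).symm⟩
      rw [hx]
      exact H.div_mem_setR (i := 2) (by omega) (by omega)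
    · refine ⟨(x, 1), adj_zero_one.2 ?_, (adj_one_two.2 (by simpa using one_mem_setR)).symm⟩
      rw [hx]
      exact H.apply_mem_setS hi
  · have hs := adj_zero_three.1 hadj
    obtain ⟨i, hi, hx⟩ := H.mem_setS.1 hs
    by_cases hi2 : i = 2
    · refine ⟨(g, 2), adj_zero_two.2 (by simpa using one_mem_setL), (adj_two_three.2 ?_).symm⟩
      rw [hx]
      exact hMW (H.apply_mem_setM (by omega))
    · refine ⟨(x, 2), adj_zero_two.2 ?_,
        (adj_two_three.2 (by simpa using hMW one_mem_setM)).symm⟩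
      rw [hx]
      exact H.apply_mem_setL (by omega) hi hi2

theorem edgesInTriangles_two (H : IsIndepSeq t h) (ht : 4 ≤ t) (hWS : W ⊆ setS t h) (g : G) :
    EdgesInTriangles (quadMatrix t h W).cay (g, 2) := by
  rintro ⟨x, j⟩ hadj
  fin_cases j
  · have hl := adj_zero_two.1 hadj.symm
    obtain hx | ⟨i, hi, hi2, hx⟩ := (H.mem_setL (by omega)).1 hl
    · refine ⟨(x, 1), (adj_one_two.2 ?_).symm, adj_zero_one.2 (by simpa using one_mem_setS)⟩
      rw [hx]
      exact H.div_mem_setR (i := 2) (by omega) (by omega)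
    · refine ⟨(g, 1), (adj_one_two.2 (by simpa using one_mem_setR)).symm, adj_zero_one.2 ?_⟩
      rw [hx]
      exact H.apply_mem_setS hi
  · have hr := adj_one_two.1 hadj.symm
    obtain hx | ⟨i, hi1, hi, hx⟩ := (H.mem_setR (by omega)).1 hr
    · refine ⟨(x, 0), (adj_zero_two.2 ?_).symm,
        (adj_zero_one.2 (by simpa using one_mem_setS)).symm⟩
      rw [hx]
      exact one_mem_setL
    · by_cases hi2 : i = 2
      · refine ⟨(x, 0), (adj_zero_two.2 ?_).symm,
          (adj_zero_one.2 (by simpa using one_mem_setS)).symm⟩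
        rw [hx, hi2]
        exact (H.mem_setL (by omega)).2 (Or.inl rfl)
      · refine ⟨((h (i - 1))⁻¹ * x, 0), (adj_zero_two.2 ?_).symm, (adj_zero_one.2 ?_).symm⟩
        · rw [mul_inv_eq_iff_eq_mul.1 hx]
          simpa [mul_assoc] using H.apply_mem_setL (by omega) hi hi2
        · simpa using H.apply_mem_setS (i := i - 1) (by omega)
  · exact absurd hadj not_adj_same_part
  · exact ⟨(g, 0), (adj_zero_two.2 (by simpa using one_mem_setL)).symm,
      (adj_zero_three.2 (hWS (adj_two_three.1 hadj))).symm⟩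

/-- There are no triangles with vertices in the first, second and fourth part. -/
theorem not_triangle_zero_one_three (H : IsIndepSeq t h) (ht : 4 ≤ t) {g x y : G}
    (hx : (quadMatrix t h W).cay.Adj (g, 0) (x, 1))
    (hy : (quadMatrix t h W).cay.Adj (g, 0) (y, 3)) :
    ¬ (quadMatrix t h W).cay.Adj (x, 1) (y, 3) := by
  intro hxy
  obtain ⟨i, hi, hxi⟩ := H.mem_setS.1 (adj_zero_one.1 hx)
  obtain ⟨j, hj, hyj⟩ := H.mem_setS.1 (adj_zero_three.1 hy)
  apply H.div_notMem_setN ht hj hi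
  rw [← hxi, ← hyj]
  simpa [mul_assoc] using adj_one_three.1 hxy

/-- The edges between the second and the fourth part given by `h 1 * h 2 * h 3 * h 4` lie in no
triangle. -/
theorem not_triangle_of_mul_mul_mul (H : IsIndepSeq t h) (ht : 4 ≤ t) (hWS : W ⊆ setS t h) (g : G)
    (v : G × Fin 4) (h1 : (quadMatrix t h W).cay.Adj (g, 1) v)
    (h3 : (quadMatrix t h W).cay.Adj (h 1 * h 2 * h 3 * h 4 * g, 3) v) : False := by
  obtain ⟨x, j⟩ := v
  have hN : (quadMatrix t h W).cay.Adj (g, 1) (h 1 * h 2 * h 3 * h 4 * g, 3) :=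
    adj_one_three.2 (by simp [setN])
  fin_cases j
  · exact H.not_triangle_zero_one_three ht h1.symm h3.symm hN
  · exact not_adj_same_part h1
  · exact H.mul_mul_mul_ne_mul ht (hWS (adj_two_three.1 h3.symm)) (adj_one_two.1 h1) (by group)
  · exact not_adj_same_part h3

theorem edgesInTriangles_iff (H : IsIndepSeq t h) (ht : 4 ≤ t) (hMW : setM t h ⊆ W)
    (hWS : W ⊆ setS t h) (v : G × Fin 4) :
    EdgesInTriangles (quadMatrix t h W).cay v ↔ v.2 = 0 ∨ v.2 = 2 := by
  obtain ⟨g, j⟩ := v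
  have hN : ∀ g, (quadMatrix t h W).cay.Adj (g, 1) (h 1 * h 2 * h 3 * h 4 * g, 3) := fun g =>
    adj_one_three.2 (by simp [setN])
  fin_cases j
  · simpa using H.edgesInTriangles_zero ht hMW g
  · refine iff_of_false (fun hE => ?_) (by simp)
    obtain ⟨v, h1, h3⟩ := hE _ (hN g)
    exact H.not_triangle_of_mul_mul_mul ht hWS g v h1 h3
  · simpa using H.edgesInTriangles_two ht hWS g
  · refine iff_of_false (fun hE => ?_) (by simp)
    obtain ⟨g, rfl⟩ : ∃ x, g = h 1 * h 2 * h 3 * h 4 * x :=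
      ⟨(h 1 * h 2 * h 3 * h 4)⁻¹ * g, (mul_inv_cancel_left _ _).symm⟩
    obtain ⟨v, h3, h1⟩ := hE _ (hN g).symm
    exact H.not_triangle_of_mul_mul_mul ht hWS g v h1 h3

theorem inSparseTriangle_two (H : IsIndepSeq t h) (ht : 4 ≤ t) (hMW : setM t h ⊆ W)
    (hWS : W ⊆ setS t h) (g : G) : InSparseTriangle (quadMatrix t h W).cay (g, 2) := by
  refine ⟨((h 2 * (h 1)⁻¹)⁻¹ * g, 1), (h 3 * g, 3), (adj_one_two.2 ?_).symm, adj_two_three.2 ?_,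
    adj_one_three.2 ?_, ?_, ?_⟩
  · simpa using H.div_mem_setR (i := 2) (by omega) (by omega)
  · simpa using hMW (H.apply_mem_setM (i := 3) (by omega))
  · exact mem_setN.2 (Or.inr (Or.inr (Or.inr ⟨3, le_rfl, by omega, by group⟩)))
  · simp [H.edgesInTriangles_iff ht hMW hWS]
  · simp [H.edgesInTriangles_iff ht hMW hWS]

theorem not_inSparseTriangle_zero (H : IsIndepSeq t h) (ht : 4 ≤ t) (hMW : setM t h ⊆ W)
    (hWS : W ⊆ setS t h) (g : G) : ¬ InSparseTriangle (quadMatrix t h W).cay (g, 0) := by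
  rintro ⟨⟨x, i⟩, ⟨y, j⟩, hx, hy, hxy, hEx, hEy⟩
  rw [H.edgesInTriangles_iff ht hMW hWS] at hEx hEy
  fin_cases i <;> fin_cases j <;> simp at hEx hEy
  · exact not_adj_same_part hxy
  · exact H.not_triangle_zero_one_three ht hx hy hxy
  · exact H.not_triangle_zero_one_three ht hy hx hxy.symm
  · exact not_adj_same_part hxy

/-- Automorphisms preserve the first part. -/
theorem apply_snd_eq_zero_iff (H : IsIndepSeq t h) (ht : 4 ≤ t) (hMW : setM t h ⊆ W)
    (hWS : W ⊆ setS t h) (φ : (quadMatrix t h W).cay ≃g (quadMatrix t h W).cay)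
    (v : G × Fin 4) : (φ v).2 = 0 ↔ v.2 = 0 := by
  have key : ∀ v : G × Fin 4, v.2 = 0 ↔ EdgesInTriangles (quadMatrix t h W).cay v ∧
      ¬ InSparseTriangle (quadMatrix t h W).cay v := by
    rintro ⟨g, j⟩
    rw [H.edgesInTriangles_iff ht hMW hWS]
    fin_cases j
    · simpa using H.not_inSparseTriangle_zero ht hMW hWS g
    · simp
    · simpa using H.inSparseTriangle_two ht hMW hWS g
    · simp
  rw [key, key, edgesInTriangles_apply_iff, inSparseTriangle_apply_iff]

/-- Automorphisms preserve the third part. -/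
theorem apply_snd_eq_two_iff (H : IsIndepSeq t h) (ht : 4 ≤ t) (hMW : setM t h ⊆ W)
    (hWS : W ⊆ setS t h) (φ : (quadMatrix t h W).cay ≃g (quadMatrix t h W).cay)
    (v : G × Fin 4) : (φ v).2 = 2 ↔ v.2 = 2 := by
  have key : ∀ v : G × Fin 4, v.2 = 2 ↔ EdgesInTriangles (quadMatrix t h W).cay v ∧
      InSparseTriangle (quadMatrix t h W).cay v := by
    rintro ⟨g, j⟩
    rw [H.edgesInTriangles_iff ht hMW hWS]
    fin_cases j
    · simpa using H.not_inSparseTriangle_zero ht hMW hWS g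
    · simp
    · simpa using H.inSparseTriangle_two ht hMW hWS g
    · simp
  rw [key, key, edgesInTriangles_apply_iff, inSparseTriangle_apply_iff]

end IsIndepSeq
end Quad

/-! ### Separating the second part from the fourth -/

section Rigidity

variable {G : Type*} [Group G] {t : ℕ} {h : ℕ → G} {W : Set G}

namespace IsIndepSeq

theorem ncard_commonNeighbors_le (H : IsIndepSeq t h) (ht : 2 ≤ t) (hWS : W ⊆ setS t h) {g x : G}
    (hadj : (quadMatrix t h W).cay.Adj (g, 0) (x, 2)) (hne : x ≠ g) :
    ((quadMatrix t h W).cay.commonNeighbors (g, 0) (x, 2)).ncard ≤ 5 := by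
  classical
  have hl := adj_zero_two.1 hadj
  obtain ⟨p, q, hpq⟩ := H.exists_pair_of_mul_inv_mem_setS ht hl
    (fun h1 => hne (mul_inv_eq_one.1 h1))
  obtain ⟨a, b, c, habc⟩ := H.exists_triple_of_mul_inv_mem_setR ht hl
  have hsub : (quadMatrix t h W).cay.commonNeighbors (g, 0) (x, 2) ⊆
      (({(p * g, 3), (q * g, 3), (a * g, 1), (b * g, 1), (c * g, 1)} : Finset (G × Fin 4)) :
        Set (G × Fin 4)) := by
    rintro ⟨y, j⟩ hy
    obtain ⟨h0, h2⟩ := (SimpleGraph.mem_commonNeighbors _).1 hy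
    fin_cases j
    · exact absurd h0 not_adj_same_part
    · have h3 := habc (y * g⁻¹) (adj_zero_one.1 h0) (by simpa using adj_one_two.1 h2.symm)
      simp only [mul_inv_eq_iff_eq_mul] at h3
      rcases h3 with rfl | rfl | rfl <;> simp
    · exact absurd h2 not_adj_same_part
    · have h3 := hpq (y * g⁻¹) (adj_zero_three.1 h0)
        (by simpa using hWS (adj_two_three.1 h2))
      simp only [mul_inv_eq_iff_eq_mul] at h3
      rcases h3 with rfl | rfl <;> simp
  refine (Set.ncard_le_ncard hsub (Set.toFinite _)).trans ?_
  rw [Set.ncard_coe_finset]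
  exact Finset.card_le_five

theorem six_le_ncard_commonNeighbors [Finite G] (H : IsIndepSeq t h) (ht : 4 ≤ t) (g : G) :
    6 ≤ ((quadMatrix t h (setS t h)).cay.commonNeighbors (g, 0) (g, 2)).ncard := by
  have hsub : insert (g, 1) ((fun s => (s * g, 3)) '' setS t h) ⊆
      (quadMatrix t h (setS t h)).cay.commonNeighbors (g, 0) (g, 2) := by
    rintro _ (rfl | ⟨s, hs, rfl⟩)
    · exact ⟨adj_zero_one.2 (by simpa using one_mem_setS),
        (adj_one_two.2 (by simpa using one_mem_setR)).symm⟩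
    · exact ⟨adj_zero_three.2 (by simpa using hs), adj_two_three.2 (by simpa using hs)⟩
  refine le_trans ?_ (Set.ncard_le_ncard hsub (Set.toFinite _))
  rw [Set.ncard_insert_of_notMem (by simp) (Set.toFinite _), Set.InjOn.ncard_image
    (fun a _ b _ hab => by simpa using hab), H.ncard_setS]
  omega

/-- The edges joining `(g, 0)` to `(g, 2)` in `Γ₄` are recognized by their numbers of common
neighbours, so automorphisms permute them. -/
theorem exists_apply_eq_of_setS [Finite G] (H : IsIndepSeq t h) (ht : 4 ≤ t)
    (φ : (quadMatrix t h (setS t h)).cay ≃g (quadMatrix t h (setS t h)).cay) (g : G) :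
    ∃ a, φ (g, 0) = (a, 0) ∧ φ (g, 2) = (a, 2) := by
  have hMS : setM t h ⊆ setS t h := setM_subset_setS
  obtain ⟨a, ha⟩ : ∃ a, φ (g, 0) = (a, 0) :=
    ⟨_, Prod.ext rfl ((H.apply_snd_eq_zero_iff ht hMS subset_rfl φ _).2 rfl)⟩
  obtain ⟨b, hb⟩ : ∃ b, φ (g, 2) = (b, 2) :=
    ⟨_, Prod.ext rfl ((H.apply_snd_eq_two_iff ht hMS subset_rfl φ _).2 rfl)⟩
  refine ⟨a, ha, ?_⟩
  have hadj : (quadMatrix t h (setS t h)).cay.Adj (a, 0) (b, 2) := by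
    rw [← ha, ← hb, φ.map_adj_iff]
    exact adj_zero_two.2 (by simpa using one_mem_setL)
  have himage : φ '' (quadMatrix t h (setS t h)).cay.commonNeighbors (g, 0) (g, 2) ⊆
      (quadMatrix t h (setS t h)).cay.commonNeighbors (a, 0) (b, 2) := by
    rintro _ ⟨v, ⟨h0, h2⟩, rfl⟩
    rw [← ha, ← hb]
    exact ⟨φ.map_adj_iff.2 h0, φ.map_adj_iff.2 h2⟩
  have h6 := (H.six_le_ncard_commonNeighbors ht g).trans
    ((Set.ncard_image_of_injective _ φ.injective).symm.le.trans
      (Set.ncard_le_ncard himage (Set.toFinite _)))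
  by_contra hne
  have h5 := H.ncard_commonNeighbors_le (by omega) subset_rfl hadj
    (fun hba => hne (by rw [hb, hba]))
  omega

/-- All parts are preserved as soon as no automorphism maps a vertex of the fourth part into the
second. -/
theorem apply_snd_eq (H : IsIndepSeq t h) (ht : 4 ≤ t) (hMW : setM t h ⊆ W) (hWS : W ⊆ setS t h)
    (key : ∀ (φ : (quadMatrix t h W).cay ≃g (quadMatrix t h W).cay) (g : G), (φ (g, 3)).2 ≠ 1)
    (φ : (quadMatrix t h W).cay ≃g (quadMatrix t h W).cay) (v : G × Fin 4) :
    (φ v).2 = v.2 := by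
  have h0 := H.apply_snd_eq_zero_iff ht hMW hWS φ v
  have h2 := H.apply_snd_eq_two_iff ht hMW hWS φ v
  obtain ⟨g, j⟩ := v
  have h3 : j = 3 → (φ (g, j)).2 ≠ 1 := by
    rintro rfl
    exact key φ g
  have h1 : j = 1 → (φ (g, j)).2 ≠ 3 := by
    rintro rfl hφ
    apply key φ.symm (φ (g, 1)).1
    have hw : ((φ (g, 1)).1, 3) = φ (g, 1) := Prod.ext rfl hφ.symm
    rw [hw, RelIso.symm_apply_apply]
  generalize (φ (g, j)).2 = i at *
  fin_cases i <;> fin_cases j <;> simp_all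

/-- In `Γ₄` a vertex of the fourth part adjacent to `(g, 0)` is also adjacent to `(g, 2)`, which
fails in the second part. -/
theorem apply_snd_eq_of_setS [Finite G] (H : IsIndepSeq t h) (ht : 4 ≤ t)
    (φ : (quadMatrix t h (setS t h)).cay ≃g (quadMatrix t h (setS t h)).cay)
    (v : G × Fin 4) : (φ v).2 = v.2 := by
  refine H.apply_snd_eq ht setM_subset_setS subset_rfl (fun φ g hφ => ?_) φ v
  obtain ⟨x, hx⟩ : ∃ x, φ (g, 3) = (x, 1) := ⟨_, Prod.ext rfl hφ⟩
  obtain ⟨a, ha0, ha2⟩ := H.exists_apply_eq_of_setS ht φ.symm ((h 2)⁻¹ * x)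
  rw [RelIso.symm_apply_eq] at ha0 ha2
  have h1 : (quadMatrix t h (setS t h)).cay.Adj (a, 0) (g, 3) := by
    rw [← φ.map_adj_iff, ← ha0, hx]
    exact adj_zero_one.2 (by simpa using H.apply_mem_setS (i := 2) (by omega))
  have h2 : (quadMatrix t h (setS t h)).cay.Adj (a, 2) (g, 3) :=
    adj_two_three.2 (adj_zero_three.1 h1)
  rw [← φ.map_adj_iff, ← ha2, hx] at h2
  have h3 := adj_one_two.1 h2.symm
  have := H.index_close_of_mul_eq (i := 0) (j := 2) (by omega) (by omega) (by omega) h3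
    (by simp [H.zero])
  omega

theorem valency_quadMatrix [Finite G] (H : IsIndepSeq t h) (ht : 4 ≤ t) (g : G) :
    valency (quadMatrix t h W).cay (g, 0) = 3 * t + 3 ∧
    valency (quadMatrix t h W).cay (g, 1) = 3 * t + 3 ∧
    valency (quadMatrix t h W).cay (g, 2) = 2 * t + 2 + W.ncard ∧
    valency (quadMatrix t h W).cay (g, 3) = 2 * t + 2 + W.ncard := by
  have hinv : ∀ A : Set G, (A⁻¹).ncard = A.ncard := fun A => Set.natCard_inv A
  simp only [ConnectionMatrix.valency_cay, Fin.sum_univ_four]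
  simp [quadMatrix, ConnectionMatrix.ofUpper, hinv, H.ncard_setS, H.ncard_setL (by omega),
    H.ncard_setR (by omega), H.ncard_setN ht]
  omega

/-- In `Σ₄` the second and the fourth part differ in valency. -/
theorem apply_snd_eq_of_setM [Finite G] (H : IsIndepSeq t h) (ht : 4 ≤ t)
    (φ : (quadMatrix t h (setM t h)).cay ≃g (quadMatrix t h (setM t h)).cay)
    (v : G × Fin 4) : (φ v).2 = v.2 := by
  refine H.apply_snd_eq ht subset_rfl setM_subset_setS (fun φ g hφ => ?_) φ v
  have h1 := valency_apply φ (g, 3)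
  rw [show φ (g, 3) = ((φ (g, 3)).1, 1) from Prod.ext rfl hφ,
    (H.valency_quadMatrix ht _).2.1, (H.valency_quadMatrix ht _).2.2.2,
    H.ncard_setM (by omega)] at h1
  omega

/-! ### Rigidity -/

/-- A permutation of `G` compatible with the connection sets `S`, `L` and `R` is a right
translation. Indeed `S ∩ R = {1, h 1}` and `L \ S = {h 2 * (h 1)⁻¹}` show that it commutes with
the left translations by `h 1` and `h 2`, and `R` links each `h i` to `h (i + 1)`. -/
theorem eq_mul_of_preserves (H : IsIndepSeq t h) (ht : 2 ≤ t)
    (hgen : Subgroup.closure (h '' Set.Icc 1 t) = ⊤) {f : G → G} (hf : Function.Injective f)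
    (hS : ∀ x y, f y * (f x)⁻¹ ∈ setS t h ↔ y * x⁻¹ ∈ setS t h)
    (hL : ∀ x y, f y * (f x)⁻¹ ∈ setL t h ↔ y * x⁻¹ ∈ setL t h)
    (hR : ∀ x y, f y * (f x)⁻¹ ∈ setR t h ↔ y * x⁻¹ ∈ setR t h) (g : G) : f g = g * f 1 := by
  have key : ∀ i, i ≤ t → ∀ g, f (h i * g) = h i * f g := by
    have h1 : ∀ g, f (h 1 * g) = h 1 * f g := by
      intro g
      obtain h1 | h1 := H.eq_of_mem_setS_of_mem_setR (by omega)
        ((hS g (h 1 * g)).2 (by simpa using H.apply_mem_setS (i := 1) (by omega)))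
        ((hR g (h 1 * g)).2 (by simpa using apply_one_mem_setR))
      · have h2 := hf (mul_inv_eq_one.1 h1)
        rw [mul_eq_right, ← H.zero] at h2
        exact absurd (H.injOn (by omega) (by omega) h2) (by omega)
      · exact mul_inv_eq_iff_eq_mul.1 h1
    have h2 : ∀ g, f (h 2 * g) = h 2 * f g := by
      intro g
      have h3 : f (h 2 * (h 1)⁻¹ * (h 1 * g)) = h 2 * (h 1)⁻¹ * f (h 1 * g) := by
        obtain h4 | ⟨i, hi, hi2, h4⟩ := (H.mem_setL (by omega)).1
          ((hL (h 1 * g) (h 2 * (h 1)⁻¹ * (h 1 * g))).2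
            (by rw [mul_inv_cancel_right]; exact (H.mem_setL (by omega)).2 (Or.inl rfl)))
        · exact mul_inv_eq_iff_eq_mul.1 h4
        · have h5 := H.apply_mem_setS hi
          rw [← h4, hS, mul_inv_cancel_right] at h5
          exact absurd h5 (H.div_notMem_setS ht)
      rw [h1] at h3
      simpa [mul_assoc] using h3
    intro i
    induction i using Nat.strong_induction_on with
    | _ i ih =>
      intro hi g
      by_cases hi2 : i ≤ 2
      · obtain rfl | rfl | rfl : i = 0 ∨ i = 1 ∨ i = 2 := by omega
        · simp [H.zero]
        · exact h1 g
        · exact h2 g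
      · obtain ⟨k, hk, hik⟩ := H.mem_setS.1
          ((hS g (h i * g)).2 (by simpa using H.apply_mem_setS hi))
        rw [mul_inv_eq_iff_eq_mul] at hik
        have hr : f (h i * g) * (f (h (i - 1) * g))⁻¹ ∈ setR t h :=
          (hR _ _).2 (by simpa [mul_assoc] using H.div_mem_setR (i := i) (by omega) hi)
        rw [hik, ih (i - 1) (by omega) (by omega)] at hr
        -- the values `k = i - 1` and `k = i - 2` are already taken
        have hlt : ¬ k < i := by
          intro hki
          rw [← ih k hki hk g] at hik
          have := H.injOn hi hk (mul_right_cancel (hf hik))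
          omega
        obtain h3 | h3 | h3 := H.index_close_of_mul_eq (by omega) hk (by omega : i - 1 ≤ t) hr
          (by group)
        · omega
        · rw [hik, h3, Nat.sub_add_cancel (by omega)]
        · omega
  have hall : ∀ x ∈ Subgroup.closure (h '' Set.Icc 1 t), ∀ g, f (x * g) = x * f g := by
    intro x hx
    induction hx using Subgroup.closure_induction with
    | mem x hx =>
      obtain ⟨i, hi, rfl⟩ := hx
      exact key i hi.2
    | one => simp
    | mul x y _ _ hx hy => exact fun g => by rw [mul_assoc, hx, hy, mul_assoc]
    | inv x _ hx => exact fun g => by rw [eq_inv_mul_iff_mul_eq, ← hx, mul_inv_cancel_left]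
  simpa using hall g (hgen ▸ Subgroup.mem_top g) 1

/-- If all automorphisms preserve the four parts, then they are the right translations. -/
theorem isRigid_quadMatrix (H : IsIndepSeq t h) (ht : 4 ≤ t)
    (hgen : Subgroup.closure (h '' Set.Icc 1 t) = ⊤) (hMW : setM t h ⊆ W) (hWS : W ⊆ setS t h)
    (hpart : ∀ (φ : (quadMatrix t h W).cay ≃g (quadMatrix t h W).cay) (v : G × Fin 4),
      (φ v).2 = v.2) : (quadMatrix t h W).IsRigid := by
  intro φ
  have happ : ∀ g i, φ (g, i) = ((φ (g, i)).1, i) := fun g i => Prod.ext rfl (hpart φ _)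
  have hadj : ∀ g x i j, (quadMatrix t h W).cay.Adj ((φ (g, i)).1, i) ((φ (x, j)).1, j) ↔
      (quadMatrix t h W).cay.Adj (g, i) (x, j) := fun g x i j => by
    rw [← happ, ← happ, φ.map_adj_iff]
  have hinj : ∀ g x i, (φ (g, i)).1 = (φ (x, i)).1 → g = x := fun g x i hgx => by
    have h1 : φ (g, i) = φ (x, i) := by rw [happ g, happ x, hgx]
    exact congrArg Prod.fst (φ.injective h1)
  -- the common neighbours `(h i * g, 3)`, `i ≤ 2`, of `(g, 0)` and `(g, 2)`
  have h20 : ∀ g, (φ (g, 2)).1 = (φ (g, 0)).1 := by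
    intro g
    by_contra hne
    have hl := adj_zero_two.1 ((hadj g g 0 2).2 (adj_zero_two.2 (by simpa using one_mem_setL)))
    obtain ⟨p, q, hpq⟩ := H.exists_pair_of_mul_inv_mem_setS (by omega) hl
      (fun h1 => hne (mul_inv_eq_one.1 h1))
    have hi : ∀ i, i ≤ 2 → (φ (h i * g, 3)).1 * ((φ (g, 0)).1)⁻¹ = p ∨
        (φ (h i * g, 3)).1 * ((φ (g, 0)).1)⁻¹ = q := by
      intro i hi
      apply hpq
      · exact adj_zero_three.1 ((hadj g _ 0 3).2 (adj_zero_three.2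
          (by simpa using H.apply_mem_setS (by omega))))
      · have h3 := adj_two_three.1 ((hadj g (h i * g) 2 3).2 (adj_two_three.2
          (by simpa using hMW (H.apply_mem_setM (i := i) (by omega)))))
        simpa using hWS h3
    have hij : ∀ i j, i ≤ 2 → j ≤ 2 → (φ (h i * g, 3)).1 * ((φ (g, 0)).1)⁻¹ =
        (φ (h j * g, 3)).1 * ((φ (g, 0)).1)⁻¹ → i = j := fun i j hi hj he =>
      H.injOn (by omega) (by omega) (mul_right_cancel (hinj _ _ _ (mul_right_cancel he)))
    have h01 := hij 0 1 (by omega) (by omega)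
    have h02 := hij 0 2 (by omega) (by omega)
    have h12 := hij 1 2 (by omega) (by omega)
    rcases hi 0 (by omega) with h0 | h0 <;> rcases hi 1 (by omega) with h1 | h1 <;>
      rcases hi 2 (by omega) with h2 | h2 <;>
      first
      | exact absurd (h01 (h0.trans h1.symm)) (by omega)
      | exact absurd (h02 (h0.trans h2.symm)) (by omega)
      | exact absurd (h12 (h1.trans h2.symm)) (by omega)
  -- the common neighbours `(l * g, 2)` of `(g, 0)` and `(g, 1)` with `l` in `L ∩ R`
  have h10 : ∀ g, (φ (g, 1)).1 = (φ (g, 0)).1 := by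
    intro g
    have hs := adj_zero_one.1 ((hadj g g 0 1).2 (adj_zero_one.2 (by simpa using one_mem_setS)))
    have hr := adj_one_two.1 ((hadj g g 1 2).2 (adj_one_two.2 (by simpa using one_mem_setR)))
    rw [h20] at hr
    obtain ⟨j, hj, hsj⟩ := H.mem_setS.1 hs
    have hj1 := H.index_close_of_mul_eq (i := 0) (by omega) (by omega) hj hr
      (by rw [← hsj, H.zero]; group)
    obtain rfl | rfl : j = 0 ∨ j = 1 := by omega
    · rw [H.zero] at hsj
      exact mul_inv_eq_one.1 hsj
    · exfalso
      have hl : ∀ l, l ∈ setL t h → l ∈ setR t h →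
          (φ (l * g, 2)).1 * ((φ (g, 0)).1)⁻¹ = h 1 ∨
          (φ (l * g, 2)).1 * ((φ (g, 0)).1)⁻¹ = h 1 * h 1 := by
        intro l hlL hlR
        apply H.eq_of_mul_inv_mem_setR (by omega)
        · exact adj_zero_two.1 ((hadj g _ 0 2).2 (adj_zero_two.2 (by simpa using hlL)))
        · have h3 := adj_one_two.1 ((hadj g (l * g) 1 2).2 (adj_one_two.2 (by simpa using hlR)))
          rw [← hsj]
          simpa using h3
      have hinj2 : ∀ l l', (φ (l * g, 2)).1 * ((φ (g, 0)).1)⁻¹ =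
          (φ (l' * g, 2)).1 * ((φ (g, 0)).1)⁻¹ → l = l' := fun l l' he =>
        mul_right_cancel (hinj _ _ _ (mul_right_cancel he))
      have hS2 := H.div_notMem_setS (by omega)
      have hne1 : (1 : G) ≠ h 1 := fun he =>
        absurd (H.injOn (i := 0) (j := 1) (by omega) (by omega) (H.zero.trans he)) (by omega)
      have hne2 : (1 : G) ≠ h 2 * (h 1)⁻¹ := fun he => hS2 (he ▸ one_mem_setS)
      have hne3 : h 1 ≠ h 2 * (h 1)⁻¹ := fun he => hS2 (he ▸ H.apply_mem_setS (by omega))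
      have e0 := hl 1 one_mem_setL one_mem_setR
      have e1 := hl (h 1) (H.apply_mem_setL (by omega) (by omega) (by omega)) apply_one_mem_setR
      have e2 := hl (h 2 * (h 1)⁻¹) ((H.mem_setL (by omega)).2 (Or.inl rfl))
        (H.div_mem_setR (i := 2) (by omega) (by omega))
      rcases e0 with e0 | e0 <;> rcases e1 with e1 | e1 <;> rcases e2 with e2 | e2 <;>
        first
        | exact hne1 (hinj2 _ _ (e0.trans e1.symm))
        | exact hne2 (hinj2 _ _ (e0.trans e2.symm))
        | exact hne3 (hinj2 _ _ (e1.trans e2.symm))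
  have hf := H.eq_mul_of_preserves (by omega) hgen (f := fun g => (φ (g, 0)).1)
    (fun g x => hinj g x 0)
    (fun x y => by simpa only [adj_zero_one, h10] using hadj x y 0 1)
    (fun x y => by simpa only [adj_zero_two, h20] using hadj x y 0 2)
    (fun x y => by simpa only [adj_one_two, h10, h20] using hadj x y 1 2)
  refine ⟨(φ (1, 0)).1, ?_⟩
  have h30 : ∀ g, (φ (g, 3)).1 = g * (φ (1, 0)).1 := by
    intro g
    have hw : (φ (g, 3)).1 * ((φ (1, 0)).1)⁻¹ * g⁻¹ = 1 := by
      refine H.eq_one_of_mul_mem_setS (by omega) fun s hs => ?_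
      have h3 := adj_zero_three.1 ((hadj (s⁻¹ * g) g 0 3).2 (adj_zero_three.2 (by simpa using hs)))
      rw [hf (s⁻¹ * g)] at h3
      simpa [mul_assoc] using h3
    rw [mul_inv_eq_one, mul_inv_eq_iff_eq_mul] at hw
    exact hw
  rintro ⟨g, i⟩
  rw [happ]
  fin_cases i
  · exact congrArg (·, (0 : Fin 4)) (hf g)
  · exact congrArg (·, (1 : Fin 4)) ((h10 g).trans (hf g))
  · exact congrArg (·, (2 : Fin 4)) ((h20 g).trans (hf g))
  · exact congrArg (·, (3 : Fin 4)) (h30 g)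

end IsIndepSeq
end Rigidity

/-! ### The graphs `Γ₄` and `Σ₄` -/

theorem hasThreeCycleAt_sigmaFour {G : Type*} [Group G] {t : ℕ} {h : ℕ → G} (g : G) (i : Fin 4) :
    HasThreeCycleAt (sigmaFour t h).cay (g, i) := by
  change HasThreeCycleAt (quadMatrix t h (setM t h)).cay (g, i)
  have h01 : (quadMatrix t h (setM t h)).cay.Adj (g, 0) (g, 1) :=
    adj_zero_one.2 (by simp [setS])
  have h02 : (quadMatrix t h (setM t h)).cay.Adj (g, 0) (g, 2) :=
    adj_zero_two.2 (by simp [setL])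
  have h12 : (quadMatrix t h (setM t h)).cay.Adj (g, 1) (g, 2) :=
    adj_one_two.2 (by simp [setR])
  have h03 : (quadMatrix t h (setM t h)).cay.Adj (g, 0) (g, 3) :=
    adj_zero_three.2 (by simp [setS])
  have h23 : (quadMatrix t h (setM t h)).cay.Adj (g, 2) (g, 3) :=
    adj_two_three.2 (by simp [setM])
  fin_cases i
  · exact hasThreeCycleAt_of_adj h01 h12 h02
  · exact hasThreeCycleAt_of_adj h12 h02.symm h01.symm
  · exact hasThreeCycleAt_of_adj h23 h03.symm h02.symm
  · exact hasThreeCycleAt_of_adj h23.symm h02.symm h03.symm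

theorem lemma6p1 {G : Type*} [Group G] [Finite G] (t : ℕ) (ht : 4 ≤ t)
    (hd : Group.rank G = t) (h : ℕ → G)
    (hgen : Subgroup.closure (h '' Set.Icc 1 t) = ⊤)
    (hord : (¬ ∀ g : G, g ^ 2 = 1) → 3 ≤ orderOf (h 1)) :
    IsHGR 4 G (gammaFour t h).cay ∧
      (sigmaFour t h).IsPGSR ∧ ValencyCycleConditions (sigmaFour t h).cay := by
  have H := isIndepSeq_update_zero hd hgen
  -- the connection sets do not depend on `h 0`, which is replaced by `1`
  obtain ⟨h', hh', H⟩ : ∃ h' : ℕ → G, (∀ i, i ≠ 0 → h i = h' i) ∧ IsIndepSeq t h' :=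
    ⟨_, fun i hi => (Function.update_of_ne hi _ _).symm, H⟩
  have himage : ∀ a b, 1 ≤ a → h '' Set.Icc a b = h' '' Set.Icc a b := fun a b ha =>
    Set.image_congr fun i hi => hh' i (by have := hi.1; omega)
  have hS : setS t h = setS t h' := by rw [setS, setS, himage 1 t le_rfl]
  have hM : setM t h = setM t h' := by rw [setM, setM, himage 1 (t - 1) le_rfl]
  have hL : setL t h = setL t h' := by
    rw [setL, setL, himage 3 t (by omega), hh' 1 (by omega), hh' 2 (by omega)]
  have hR : setR t h = setR t h' := by
    rw [setR, setR, hh' 1 (by omega)]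
    congr 1
    exact Set.image_congr fun i hi => by
      have := hi.1
      simp only [hh' i (by omega), hh' (i - 1) (by omega)]
  have hN : setN t h = setN t h' := by
    rw [setN, setN, hh' 1 (by omega), hh' 2 (by omega), hh' 3 (by omega), hh' 4 (by omega)]
    congr 1
    exact Set.image_congr fun i hi => by
      have := hi.1
      simp only [hh' i (by omega)]
  have hgamma : gammaFour t h = quadMatrix t h' (setS t h') := by
    rw [gammaFour, quadMatrix, hS, hL, hR, hN]
  have hsigma : sigmaFour t h = quadMatrix t h' (setM t h') := by
    rw [sigmaFour, quadMatrix, hS, hL, hR, hN, hM]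
  rw [himage 1 t le_rfl] at hgen
  have hGrigid := H.isRigid_quadMatrix ht hgen IsIndepSeq.setM_subset_setS subset_rfl
    (H.apply_snd_eq_of_setS ht)
  have hSrigid := H.isRigid_quadMatrix ht hgen subset_rfl IsIndepSeq.setM_subset_setS
    (H.apply_snd_eq_of_setM ht)
  refine ⟨?_, ?_, 3 * t + 2, by omega, H.three_mul_add_two_le_card ht, fun g => ?_, fun g => ?_,
    fun g i => hasThreeCycleAt_sigmaFour g i⟩
  · rw [hgamma]
    refine hGrigid.isHGR (by omega) quadMatrix_T_self ⟨3 * t + 3, ?_⟩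
    rintro ⟨g, i⟩
    obtain ⟨v0, v1, v2, v3⟩ := H.valency_quadMatrix (W := setS t h') ht g
    rw [H.ncard_setS] at v2 v3
    fin_cases i
    · exact v0
    · exact v1
    · exact v2.trans (by omega)
    · exact v3.trans (by omega)
  · rw [hsigma]
    exact ⟨quadMatrix_T_self, hSrigid.nonempty_mulEquiv⟩
  · rw [hsigma]
    obtain ⟨v0, v1, -, -⟩ := H.valency_quadMatrix (W := setM t h') ht g
    exact ⟨v0, v1⟩
  · rw [hsigma]
    obtain ⟨-, -, v2, v3⟩ := H.valency_quadMatrix (W := setM t h') ht g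
    rw [H.ncard_setM (by omega)] at v2 v3
    exact ⟨v2.trans (by omega), v3.trans (by omega)⟩
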